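/- **Setting.** A tile in $\mathbb{R}^d$ is a pair consisting of a nonempty compact set (its support) that is the closure of its interior, and a mark. A patch is a set of tiles with pairwise disjoint interiors, and a tiling is a patch whose supports cover $\mathbb{R}^d$. For a tiling $T$ let $B_0[T]$ be the set of tiles of $T$ containing $0$ and, for $R>0$, let $B_R[T]$ be the set of tiles of $T$ meeting the open ball $B_R(0)$. Two tilings are at distance less than a small $\epsilon$ when translates of them by vectors shorter than $\epsilon/2$ have the same $B_{1/\epsilon}[\cdot]$ (up to harmless boundary conventions; this is the usual tiling metric $\mathrm{d}$). Let $\Phi$ be a self-similar substitution on finitely many translationally inequivalent prototiles $\rho_1,\dots,\rho_k$ in $\mathbb{R}^d$, with expansion factor $\lambda>1$: each $\Phi(\rho_i)$ is a patch of translates of prototiles with support $\lambda\,\mathrm{spt}(\rho_i)$, and $\Phi$ extends to patches by $\Phi(\rho_i+v)=\Phi(\rho_i)+\lambda v$. Let $\Omega_\Phi$ be the set of tilings each of whose finite patches is contained in a translate of some $\Phi^m(\rho_i)$, $m\ge 1$. Assume that $\Omega_\Phi$ has finite local complexity (for each $R$ there are, up to translation, finitely many patches of diameter at most $R$ in the tilings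 of $\Omega_\Phi$) and is non-periodic ($T\in\Omega_\Phi$ and $T-v=T$ imply $v=0$). Write $T\sim_s T'$ if $T,T'\in\Omega_\Phi$ and $\mathrm{d}(\Phi^n(T),\Phi^n(T'))\to 0$ as $n\to\infty$. A *branch pair* is a pair $(T,T')\in\Omega_\Phi\times\Omega_\Phi$ with $T\not\sim_s T'$ for which there is an open half-space $H=\{x:\langle x,w\rangle>0\}$, $|w|=1$, with $T-x\sim_s T'-x$ for all $x\in H$. An *asymptotic sector* of the pair is the connected component of $\{v\in\mathbb{S}^{d-1}: T-tv\sim_s T'-tv \text{ for all } t>0\}$ containing $H\cap\mathbb{S}^{d-1}$, for such an $H$. **Proposition.** Let $T\neq T'$ in $\Omega_\Phi$, let $u\in\mathbb{S}^{d-1}$ and $\alpha\le 0$, and put $D=\{v\in\mathbb{S}^{d-1}:\langle v,u\rangle>\alpha\}$. Suppose that $T$ and $T'$ agree on the open cone $X=\{tv: t>0,\ v\in D\}$, that is, $B_0[T-x]=B_0[T'-x]$ for all $x\in X$. Then there is a branch pair $(\bar T,\bar T')$ with an asymptotic sector that contains $D$. Moreover, if $\alpha<0$, this pair may be taken to be $(\bar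 T,\bar T')=(T-z,T'-z)$ for some $z\in\mathbb{R}^d$. -/

import Mathlib

open Set Filter Topology
open scoped Pointwise

noncomputable section

namespace SubstTiling

/-- `ℝ^d` with its Euclidean structure. -/
abbrev Space (d : ℕ) : Type := EuclideanSpace ℝ (Fin d)

/-- A (topologically regular) tile in `ℝ^d`: a nonempty compact support that is the closure of its
interior, together with a mark. -/
@[ext]
structure Tile (d : ℕ) (M : Type*) where
  supp : Set (Space d)
  mark : M
  nonempty : supp.Nonempty
  isCompact : IsCompact supp
  regular : closure (interior supp) = supp

variable {d : ℕ} {M : Type*}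

/-- Translation of tiles: `v +ᵥ τ` is the tile `τ + v`. For a set `T` of tiles, `v +ᵥ T` is then
the translated set `T + v`, and `-v +ᵥ T` is `T - v`. -/
instance : VAdd (Space d) (Tile d M) where
  vadd v τ :=
    { supp := v +ᵥ τ.supp
      mark := τ.mark
      nonempty := τ.nonempty.vadd_set
      isCompact := τ.isCompact.vadd v
      regular := by rw [interior_vadd, closure_vadd, τ.regular] }

theorem Tile.vadd_supp (v : Space d) (τ : Tile d M) : (v +ᵥ τ).supp = v +ᵥ τ.supp := rfl

theorem Tile.vadd_mark (v : Space d) (τ : Tile d M) : (v +ᵥ τ).mark = τ.mark := rfl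

instance : AddAction (Space d) (Tile d M) where
  zero_vadd τ := Tile.ext (by rw [Tile.vadd_supp, zero_vadd]) rfl
  add_vadd v w τ := Tile.ext (by simp only [Tile.vadd_supp, add_vadd]) rfl

/-- The support of a set of tiles. -/
def support (P : Set (Tile d M)) : Set (Space d) := ⋃ τ ∈ P, τ.supp

/-- A patch: distinct tiles have disjoint interiors. -/
def IsPatch (P : Set (Tile d M)) : Prop := P.PairwiseDisjoint fun τ => interior τ.supp

/-- A tiling of `ℝ^d`: a patch whose support is `ℝ^d`. -/
def IsTiling (T : Set (Tile d M)) : Prop := IsPatch T ∧ support T = univ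

/-- `B_0[T]`: the tiles of `T` that contain the origin. -/
def originPatch (T : Set (Tile d M)) : Set (Tile d M) := {τ ∈ T | (0 : Space d) ∈ τ.supp}

/-- `B_R[T]` for `R > 0`: the tiles of `T` that meet the ball of radius `R` about the origin. -/
def ballPatch (R : ℝ) (T : Set (Tile d M)) : Set (Tile d M) :=
  {τ ∈ T | (Metric.ball (0 : Space d) R ∩ τ.supp).Nonempty}

/-- `T` and `T'` agree on `X`: `B_0[T - v] = B_0[T' - v]` for all `v ∈ X`. -/
def AgreeOn (T T' : Set (Tile d M)) (X : Set (Space d)) : Prop :=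
  ∀ v ∈ X, originPatch (-v +ᵥ T) = originPatch (-v +ᵥ T')

/-- The tiling metric: the distance is at most `ε` when translates of `T` and `T'` by vectors
shorter than `ε / 2` agree on the ball of radius `1 / ε` about the origin (distances are cut off
at `1`). -/
def tilingDist (T T' : Set (Tile d M)) : ℝ :=
  sInf ({1} ∪ {ε : ℝ | 0 < ε ∧ ∃ v v' : Space d, ‖v‖ < ε / 2 ∧ ‖v'‖ < ε / 2 ∧
    ballPatch (1 / ε) (-v' +ᵥ T') = ballPatch (1 / ε) (-v +ᵥ T)})

/-- Translationally finite local complexity of a collection of tilings: for each `R`, up to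
translation there are only finitely many patches of diameter at most `R`. -/
def HasFLC (Ω : Set (Set (Tile d M))) : Prop :=
  ∀ R : ℝ, ∃ F : Set (Set (Tile d M)), F.Finite ∧
    ∀ T ∈ Ω, ∀ P ⊆ T, Metric.ediam (support P) ≤ ENNReal.ofReal R →
      ∃ Q ∈ F, ∃ v : Space d, P = v +ᵥ Q

/-- The translation action on `Ω` is free. -/
def NonPeriodic (Ω : Set (Set (Tile d M))) : Prop :=
  ∀ T ∈ Ω, ∀ v : Space d, -v +ᵥ T = T → v = 0

/-- A self-similar substitution: finitely many translationally inequivalent prototiles `proto i`,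
an expansion factor `ratio > 1`, and for each prototile a patch `rule i` of translates of
prototiles whose support is the inflated prototile. -/
structure SelfSimilarSubstitution (d : ℕ) (M : Type*) where
  card : ℕ
  proto : Fin card → Tile d M
  proto_inequiv : ∀ (i j : Fin card) (v : Space d), v +ᵥ proto i = proto j → i = j
  ratio : ℝ
  one_lt_ratio : 1 < ratio
  rule : Fin card → Set (Tile d M)
  rule_isPatch : ∀ i, IsPatch (rule i)
  rule_translate : ∀ i, ∀ τ ∈ rule i, ∃ (j : Fin card) (v : Space d), τ = v +ᵥ proto j
  rule_support : ∀ i, support (rule i) = ratio • (proto i).supp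

namespace SelfSimilarSubstitution

variable (Φ : SelfSimilarSubstitution d M)

/-- The extension of `Φ` to sets of translates of prototiles: each tile `proto i + v` is replaced by
the patch `rule i + ratio • v`. -/
def map (P : Set (Tile d M)) : Set (Tile d M) :=
  ⋃ (i : Fin Φ.card) (v : Space d) (_ : v +ᵥ Φ.proto i ∈ P), (Φ.ratio • v) +ᵥ Φ.rule i

/-- `P` is allowed: it is contained in some `Φ^m(proto i) - v` with `m ≥ 1`. -/
def IsAllowed (P : Set (Tile d M)) : Prop :=
  ∃ m : ℕ, 1 ≤ m ∧ ∃ (i : Fin Φ.card) (v : Space d), P ⊆ -v +ᵥ Φ.map^[m] {Φ.proto i}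

/-- The substitution tiling space `Ω_Φ`: the tilings all of whose finite patches are allowed. -/
def tilingSpace : Set (Set (Tile d M)) :=
  {T | IsTiling T ∧ ∀ P ⊆ T, P.Finite → Φ.IsAllowed P}

/-- The stable manifold `W^s(T)`. -/
def stableManifold (T : Set (Tile d M)) : Set (Set (Tile d M)) :=
  {T' | T' ∈ Φ.tilingSpace ∧
    Tendsto (fun n : ℕ => tilingDist (Φ.map^[n] T') (Φ.map^[n] T)) atTop (𝓝 0)}

/-- Stable equivalence `T ∼ₛ T'`. -/
def StablyEquiv (T T' : Set (Tile d M)) : Prop := T ∈ Φ.stableManifold T'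

/-- `T - x ∼ₛ T' - x` for all `x` in the open half-space `{x | ⟪x, w⟫ > 0}`. -/
def StablyEquivOnHalfSpace (T T' : Set (Tile d M)) (w : Space d) : Prop :=
  ∀ x : Space d, 0 < inner ℝ x w → Φ.StablyEquiv (-x +ᵥ T) (-x +ᵥ T')

/-- The branch pairs of `Ω_Φ`. -/
def branchPairs : Set (Set (Tile d M) × Set (Tile d M)) :=
  {p | p.1 ∈ Φ.tilingSpace ∧ p.2 ∈ Φ.tilingSpace ∧ ¬ Φ.StablyEquiv p.1 p.2 ∧
    ∃ w : Space d, ‖w‖ = 1 ∧ Φ.StablyEquivOnHalfSpace p.1 p.2 w}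

/-- The unit vectors `v` with `T - t v ∼ₛ T' - t v` for all `t > 0`. -/
def stableDirections (T T' : Set (Tile d M)) : Set (Space d) :=
  {v | ‖v‖ = 1 ∧ ∀ t : ℝ, 0 < t → Φ.StablyEquiv (-(t • v) +ᵥ T) (-(t • v) +ᵥ T')}

/-- `S` is an asymptotic sector of `(T, T')`: the connected component of the set of stable
directions that contains the open hemisphere `{v | ‖v‖ = 1, ⟪v, w⟫ > 0}` cut out by a half-space
as in the definition of a branch pair. The hemisphere is connected and contains `w`, so this is
the component of `w`. (Two opposite hemispheres may give two different sectors.) -/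
def IsAsymptoticSector (T T' : Set (Tile d M)) (S : Set (Space d)) : Prop :=
  ∃ w : Space d, ‖w‖ = 1 ∧ Φ.StablyEquivOnHalfSpace T T' w ∧
    S = connectedComponentIn (Φ.stableDirections T T') w

end SelfSimilarSubstitution

/-- The unit vectors `v` with `⟪v, u⟫ > α`. -/
def directionCap (u : Space d) (α : ℝ) : Set (Space d) := {v | ‖v‖ = 1 ∧ α < inner ℝ v u}

/-- The open cone over `directionCap u α`: all `t v` with `t > 0` and `v ∈ directionCap u α`. For
`α = 0` this is the open half-space `{x | ⟪x, u⟫ > 0}`. -/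
def directionCone (u : Space d) (α : ℝ) : Set (Space d) :=
  {x | ∃ t : ℝ, 0 < t ∧ ∃ v ∈ directionCap u α, x = t • v}

end SubstTiling

end

namespace SubstTiling

variable {d : ℕ} {M : Type*}

/-! ### Tiles, patches and translations -/

/-! Write `λ` for `Φ.ratio`, `X` for the cone, and `U(T, T')` for `coincidenceSet`: the points `x`
where `Φ^n(T)` and `Φ^n(T')` agree at `λ^n x` for some `n`. This set is open, and `x ∈ U(T, T')`
means `T - x ∼ₛ T' - x` (`stablyEquiv_neg_vadd_iff`). So a pair is a branch pair with a sector
containing `D` once `U` omits `0` and contains `X` (`branchPair_of_directionCone_subset`).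

Such a pair arises by zooming out (`exists_limit_pair`). `Φ` is onto, so `T = Φ^n(S n)` and `T' =
Φ^n(S' n)`; by compactness the preimages converge along an ultrafilter to `A`, `A'`, up to shifts
tending to `0`. Since `T` and `T'` agree on inflated balls, different shifts would give `Φ^n(A')` a
local period short relative to `λ^n`; repulsion (`eventually_repulsion`), a consequence of
non-periodicity and finite local complexity, forbids this. With a common shift `v n`, locally `U(A,
A')` is `λ^(-n) U(T, T')` moved by `-v n`. Hence it contains `X`, and it omits `0`, as otherwise `T
= T'`.

For `α < 0`, put `c n = λ^n v n`. These points lie outside `U(T, T')`, and every `c ∉ U(T, T')`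
eventually satisfies `c - c n ∉ X`. The two conditions bound `c n` because the cone is wider than a
half-space. A limit `z` of `c n` lies outside `U(T, T')`, which contains `z + X`. -/

theorem Tile.mem_vadd_supp {v x : Space d} {τ : Tile d M} :
    x ∈ (v +ᵥ τ).supp ↔ x - v ∈ τ.supp := by
  rw [Tile.vadd_supp, mem_vadd_set_iff_neg_vadd_mem, vadd_eq_add, neg_add_eq_sub]

theorem mem_vadd_iff {v : Space d} {σ : Tile d M} {P : Set (Tile d M)} :
    σ ∈ v +ᵥ P ↔ -v +ᵥ σ ∈ P := mem_vadd_set_iff_neg_vadd_mem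

theorem Tile.interior_nonempty (τ : Tile d M) : (interior τ.supp).Nonempty := by
  rw [← closure_nonempty_iff, τ.regular]
  exact τ.nonempty

/-- A point of the support farthest in the direction `v - w` would be pushed farther still by a
nonzero translation. -/
theorem Tile.eq_of_vadd_eq {v w : Space d} {τ : Tile d M} (h : v +ᵥ τ = w +ᵥ τ) : v = w := by
  obtain ⟨x, hx, hmax⟩ := τ.isCompact.exists_isMaxOn τ.nonempty
    (f := fun y => inner ℝ y (v - w)) (by fun_prop)
  have h1 : x + (v - w) ∈ τ.supp := by
    have h2 : x + v ∈ (w +ᵥ τ).supp := by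
      rw [← h, Tile.mem_vadd_supp]
      simpa using hx
    rw [Tile.mem_vadd_supp] at h2
    convert h2 using 1
    abel
  have h3 := hmax h1
  simp only [mem_ofPred_eq, inner_add_left, real_inner_self_eq_norm_sq] at h3
  have h4 : ‖v - w‖ = 0 := by
    have := sq_nonneg ‖v - w‖
    exact pow_eq_zero_iff (two_ne_zero) |>.1 (by linarith)
  exact sub_eq_zero.1 (norm_eq_zero.1 h4)

/-- Supports are closures of their interiors, so an interior point of one tile lying in another
makes the two interiors meet. -/
theorem IsPatch.eq_of_mem_interior {P : Set (Tile d M)} (hP : IsPatch P) {σ τ : Tile d M}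
    (hσ : σ ∈ P) (hτ : τ ∈ P) {x : Space d} (hxσ : x ∈ interior σ.supp) (hxτ : x ∈ τ.supp) :
    σ = τ := by
  by_contra hne
  have hd := hP hσ hτ hne
  rw [← τ.regular] at hxτ
  obtain ⟨y, hy1, hy2⟩ := mem_closure_iff.1 hxτ _ isOpen_interior hxσ
  exact Set.disjoint_left.1 hd hy1 hy2

theorem IsPatch.vadd {P : Set (Tile d M)} (hP : IsPatch P) (v : Space d) : IsPatch (v +ᵥ P) := by
  rintro _ ⟨σ, hσ, rfl⟩ _ ⟨τ, hτ, rfl⟩ hne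
  have hd := hP hσ hτ fun h => hne (by rw [h])
  change Disjoint (interior (v +ᵥ σ).supp) (interior (v +ᵥ τ).supp)
  rw [Tile.vadd_supp, Tile.vadd_supp, interior_vadd, interior_vadd]
  exact Set.disjoint_left.2 fun x hx hx' => Set.disjoint_left.1 hd
    (mem_vadd_set_iff_neg_vadd_mem.1 hx) (mem_vadd_set_iff_neg_vadd_mem.1 hx')

theorem mem_support {P : Set (Tile d M)} {x : Space d} :
    x ∈ support P ↔ ∃ τ ∈ P, x ∈ τ.supp := by
  simp [support]

theorem isTiling_iff {T : Set (Tile d M)} :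
    IsTiling T ↔ IsPatch T ∧ ∀ x, ∃ τ ∈ T, x ∈ τ.supp := by
  simp only [IsTiling, eq_univ_iff_forall, mem_support]

theorem IsTiling.exists_mem {T : Set (Tile d M)} (hT : IsTiling T) (x : Space d) :
    ∃ τ ∈ T, x ∈ τ.supp := (isTiling_iff.1 hT).2 x

theorem IsTiling.vadd {T : Set (Tile d M)} (hT : IsTiling T) (v : Space d) :
    IsTiling (v +ᵥ T) := by
  refine isTiling_iff.2 ⟨hT.1.vadd v, fun x => ?_⟩
  obtain ⟨τ, hτ, hx⟩ := hT.exists_mem (x - v)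
  exact ⟨v +ᵥ τ, vadd_mem_vadd_set hτ, Tile.mem_vadd_supp.2 hx⟩

theorem IsTiling.eq_of_subset {T P : Set (Tile d M)} (hT : IsTiling T) (hP : IsPatch P)
    (h : T ⊆ P) : T = P := by
  refine h.antisymm fun σ hσ => ?_
  obtain ⟨x, hx⟩ := σ.interior_nonempty
  obtain ⟨τ, hτ, hxτ⟩ := hT.exists_mem x
  rwa [hP.eq_of_mem_interior hσ (h hτ) hx hxτ]

/-! ### Agreement of tilings -/

/-- This form tests single tiles, without translating the tilings. -/
theorem agreeOn_iff {T T' : Set (Tile d M)} {X : Set (Space d)} :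
    AgreeOn T T' X ↔ ∀ x ∈ X, ∀ τ : Tile d M, x ∈ τ.supp → (τ ∈ T ↔ τ ∈ T') := by
  refine forall₂_congr fun x _ => ?_
  have key : ∀ (A : Set (Tile d M)) (τ : Tile d M),
      -x +ᵥ τ ∈ originPatch (-x +ᵥ A) ↔ τ ∈ A ∧ x ∈ τ.supp := by
    intro A τ
    rw [originPatch, mem_ofPred_eq, mem_vadd_iff, neg_neg, vadd_neg_vadd, Tile.mem_vadd_supp,
      zero_sub, neg_neg]
  constructor
  · intro h τ hτ
    have h1 := key T τ
    rw [h, key T' τ] at h1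
    tauto
  · intro h
    ext σ
    have h1 := key T (x +ᵥ σ)
    have h2 := key T' (x +ᵥ σ)
    rw [neg_vadd_vadd] at h1 h2
    rw [h1, h2]
    have := h (x +ᵥ σ)
    tauto

theorem AgreeOn.mem_iff {T T' : Set (Tile d M)} {X : Set (Space d)} (h : AgreeOn T T' X)
    {x : Space d} (hx : x ∈ X) {τ : Tile d M} (hτ : x ∈ τ.supp) : τ ∈ T ↔ τ ∈ T' :=
  agreeOn_iff.1 h x hx τ hτ

theorem AgreeOn.mono {T T' : Set (Tile d M)} {X Y : Set (Space d)} (h : AgreeOn T T' X)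
    (hY : Y ⊆ X) : AgreeOn T T' Y := fun v hv => h v (hY hv)

theorem AgreeOn.symm {T T' : Set (Tile d M)} {X : Set (Space d)} (h : AgreeOn T T' X) :
    AgreeOn T' T X := fun v hv => (h v hv).symm

theorem AgreeOn.trans {T T' T'' : Set (Tile d M)} {X : Set (Space d)} (h : AgreeOn T T' X)
    (h' : AgreeOn T' T'' X) : AgreeOn T T'' X := fun v hv => (h v hv).trans (h' v hv)

theorem AgreeOn.vadd {T T' : Set (Tile d M)} {X : Set (Space d)} (h : AgreeOn T T' X)
    (v : Space d) : AgreeOn (v +ᵥ T) (v +ᵥ T') (v +ᵥ X) := by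
  rw [agreeOn_iff]
  rintro _ ⟨x, hx, rfl⟩ τ hτ
  rw [mem_vadd_iff, mem_vadd_iff]
  refine h.mem_iff hx (Tile.mem_vadd_supp.2 ?_)
  simpa [add_comm] using hτ

theorem eq_of_agreeOn_dense {T T' : Set (Tile d M)} {X : Set (Space d)} (h : AgreeOn T T' X)
    (hX : Dense X) : T = T' := by
  ext τ
  obtain ⟨x, hx, hxX⟩ := hX.inter_open_nonempty _ isOpen_interior τ.interior_nonempty
  exact h.mem_iff hxX (interior_subset hx)

namespace SelfSimilarSubstitution

variable (Φ : SelfSimilarSubstitution d M)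

/-! ### The substitution map -/

theorem ratio_pos : 0 < Φ.ratio := zero_lt_one.trans Φ.one_lt_ratio

theorem ratio_ne_zero : Φ.ratio ≠ 0 := Φ.ratio_pos.ne'

theorem tendsto_ratio_pow : Tendsto (fun n : ℕ => Φ.ratio ^ n) atTop atTop :=
  tendsto_pow_atTop_atTop_of_one_lt Φ.one_lt_ratio

variable {Φ}

theorem mem_map {P : Set (Tile d M)} {σ : Tile d M} :
    σ ∈ Φ.map P ↔ ∃ (i : Fin Φ.card) (v : Space d), v +ᵥ Φ.proto i ∈ P ∧
      σ ∈ (Φ.ratio • v) +ᵥ Φ.rule i := by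
  simp [map]

theorem mem_map_iff_exists {P : Set (Tile d M)} {σ : Tile d M} :
    σ ∈ Φ.map P ↔ ∃ τ ∈ P, σ ∈ Φ.map {τ} := by
  simp only [mem_map, mem_singleton_iff]
  constructor
  · rintro ⟨i, v, h, h'⟩
    exact ⟨_, h, i, v, rfl, h'⟩
  · rintro ⟨_, h, i, v, rfl, h'⟩
    exact ⟨i, v, h, h'⟩

theorem map_mono : Monotone Φ.map := by
  intro P Q h σ hσ
  rw [mem_map] at hσ ⊢
  obtain ⟨i, v, h1, h2⟩ := hσ
  exact ⟨i, v, h h1, h2⟩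

theorem iterate_map_mono (n : ℕ) : Monotone Φ.map^[n] := map_mono.iterate n

theorem map_vadd (v : Space d) (P : Set (Tile d M)) :
    Φ.map (v +ᵥ P) = (Φ.ratio • v) +ᵥ Φ.map P := by
  ext σ
  rw [mem_vadd_iff, mem_map, mem_map]
  constructor
  · rintro ⟨i, w, h1, h2⟩
    refine ⟨i, -v + w, by rwa [mem_vadd_iff, vadd_vadd] at h1, ?_⟩
    rwa [smul_add, smul_neg, add_vadd, vadd_mem_vadd_set_iff]
  · rintro ⟨i, w, h1, h2⟩
    refine ⟨i, v + w, by rwa [mem_vadd_iff, vadd_vadd, neg_add_cancel_left], ?_⟩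
    rw [mem_vadd_iff] at h2 ⊢
    rwa [smul_add, neg_add_rev, add_vadd]

theorem iterate_map_vadd (n : ℕ) (v : Space d) (P : Set (Tile d M)) :
    Φ.map^[n] (v +ᵥ P) = (Φ.ratio ^ n • v) +ᵥ Φ.map^[n] P := by
  induction n generalizing v P with
  | zero => simp
  | succ n ih => rw [Function.iterate_succ_apply, map_vadd, ih, smul_smul, ← pow_succ,
      Function.iterate_succ_apply]

theorem map_singleton (v : Space d) (i : Fin Φ.card) :
    Φ.map {v +ᵥ Φ.proto i} = (Φ.ratio • v) +ᵥ Φ.rule i := by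
  ext σ
  rw [mem_map]
  constructor
  · rintro ⟨j, w, h1, h2⟩
    rw [mem_singleton_iff] at h1
    have hij : j = i := by
      refine Φ.proto_inequiv _ _ (-v + w) ?_
      rw [add_vadd, h1, neg_vadd_vadd]
    subst hij
    rwa [← Tile.eq_of_vadd_eq h1]
  · exact fun h => ⟨i, v, rfl, h⟩

theorem supp_subset_of_mem_map_singleton {σ τ : Tile d M} (h : σ ∈ Φ.map {τ}) :
    σ.supp ⊆ Φ.ratio • τ.supp := by
  obtain ⟨i, v, h1, h2⟩ := mem_map.1 h
  rw [mem_singleton_iff] at h1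
  subst h1
  obtain ⟨ρ, hρ, rfl⟩ := h2
  have h3 : ρ.supp ⊆ Φ.ratio • (Φ.proto i).supp := by
    rw [← Φ.rule_support]
    exact fun x hx => mem_support.2 ⟨ρ, hρ, hx⟩
  rintro _ ⟨x, hx, rfl⟩
  obtain ⟨y, hy, rfl⟩ := h3 hx
  exact ⟨v +ᵥ y, vadd_mem_vadd_set hy, by simp⟩

/-- `τ` is a translate of a prototile. -/
def IsProtoTile (Φ : SelfSimilarSubstitution d M) (τ : Tile d M) : Prop :=
  ∃ (i : Fin Φ.card) (v : Space d), τ = v +ᵥ Φ.proto i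

theorem isProtoTile_vadd_proto (v : Space d) (i : Fin Φ.card) :
    Φ.IsProtoTile (v +ᵥ Φ.proto i) := ⟨i, v, rfl⟩

theorem isProtoTile_proto (i : Fin Φ.card) : Φ.IsProtoTile (Φ.proto i) := ⟨i, 0, by simp⟩

theorem IsProtoTile.vadd {τ : Tile d M} (h : Φ.IsProtoTile τ) (v : Space d) :
    Φ.IsProtoTile (v +ᵥ τ) := by
  obtain ⟨i, w, rfl⟩ := h
  exact ⟨i, v + w, by rw [add_vadd]⟩

theorem isProtoTile_of_mem_map {P : Set (Tile d M)} {σ : Tile d M} (h : σ ∈ Φ.map P) :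
    Φ.IsProtoTile σ := by
  obtain ⟨i, v, -, ρ, hρ, rfl⟩ := mem_map.1 h
  obtain ⟨j, w, rfl⟩ := Φ.rule_translate i ρ hρ
  exact (isProtoTile_vadd_proto w j).vadd _

theorem isProtoTile_of_mem_iterate_map {P : Set (Tile d M)} (hP : ∀ τ ∈ P, Φ.IsProtoTile τ)
    (n : ℕ) : ∀ σ ∈ Φ.map^[n] P, Φ.IsProtoTile σ := by
  cases n with
  | zero => exact hP
  | succ n =>
    rw [Function.iterate_succ_apply']
    exact fun σ hσ => isProtoTile_of_mem_map hσ

theorem exists_mem_map_of_mem_supp {τ : Tile d M} (hτ : Φ.IsProtoTile τ) {x : Space d}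
    (hx : x ∈ τ.supp) : ∃ σ ∈ Φ.map {τ}, Φ.ratio • x ∈ σ.supp := by
  obtain ⟨i, v, rfl⟩ := hτ
  have h1 : Φ.ratio • (x - v) ∈ support (Φ.rule i) := by
    rw [Φ.rule_support]
    exact smul_mem_smul_set (Tile.mem_vadd_supp.1 hx)
  obtain ⟨ρ, hρ, hxρ⟩ := mem_support.1 h1
  refine ⟨(Φ.ratio • v) +ᵥ ρ, ?_, ?_⟩
  · rw [map_singleton]
    exact vadd_mem_vadd_set hρ
  · rw [Tile.mem_vadd_supp]
    rwa [smul_sub] at hxρ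

theorem isPatch_map {P : Set (Tile d M)} (hP : IsPatch P) : IsPatch (Φ.map P) := by
  intro σ hσ σ' hσ' hne
  obtain ⟨i, v, h1, h2⟩ := mem_map.1 hσ
  obtain ⟨j, w, h3, h4⟩ := mem_map.1 hσ'
  rw [← map_singleton] at h2 h4
  by_cases heq : v +ᵥ Φ.proto i = w +ᵥ Φ.proto j
  · rw [← heq, map_singleton] at h4
    rw [map_singleton] at h2
    exact (Φ.rule_isPatch i).vadd _ h2 h4 hne
  · have hd := hP h1 h3 heq
    have h5 := interior_mono (supp_subset_of_mem_map_singleton h2)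
    have h6 := interior_mono (supp_subset_of_mem_map_singleton h4)
    rw [interior_smul₀ Φ.ratio_ne_zero] at h5 h6
    refine Set.disjoint_left.2 fun x hx hx' => ?_
    exact Set.disjoint_left.1 hd ((mem_smul_set_iff_inv_smul_mem₀ Φ.ratio_ne_zero _ _).1 (h5 hx))
      ((mem_smul_set_iff_inv_smul_mem₀ Φ.ratio_ne_zero _ _).1 (h6 hx'))

theorem isPatch_iterate_map {P : Set (Tile d M)} (hP : IsPatch P) (n : ℕ) :
    IsPatch (Φ.map^[n] P) := by
  induction n with
  | zero => exact hP
  | succ n ih =>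
    rw [Function.iterate_succ_apply']
    exact isPatch_map ih

theorem isTiling_map {T : Set (Tile d M)} (hT : IsTiling T) (hp : ∀ τ ∈ T, Φ.IsProtoTile τ) :
    IsTiling (Φ.map T) := by
  refine isTiling_iff.2 ⟨isPatch_map hT.1, fun x => ?_⟩
  obtain ⟨τ, hτ, hx⟩ := hT.exists_mem (Φ.ratio⁻¹ • x)
  obtain ⟨σ, hσ, hxσ⟩ := exists_mem_map_of_mem_supp (hp τ hτ) hx
  rw [smul_inv_smul₀ Φ.ratio_ne_zero] at hxσ
  exact ⟨σ, mem_map_iff_exists.2 ⟨τ, hτ, hσ⟩, hxσ⟩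

theorem mem_iterate_map_iff_exists {n : ℕ} {P : Set (Tile d M)} {σ : Tile d M} :
    σ ∈ Φ.map^[n] P ↔ ∃ τ ∈ P, σ ∈ Φ.map^[n] {τ} := by
  induction n generalizing σ with
  | zero => simp
  | succ n ih =>
    rw [Function.iterate_succ_apply', mem_map_iff_exists]
    constructor
    · rintro ⟨ρ, hρ, hσ⟩
      obtain ⟨τ, hτ, h⟩ := ih.1 hρ
      refine ⟨τ, hτ, ?_⟩
      rw [Function.iterate_succ_apply']
      exact mem_map_iff_exists.2 ⟨ρ, h, hσ⟩
    · rintro ⟨τ, hτ, h⟩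
      rw [Function.iterate_succ_apply'] at h
      obtain ⟨ρ, hρ, hσ⟩ := mem_map_iff_exists.1 h
      exact ⟨ρ, ih.2 ⟨τ, hτ, hρ⟩, hσ⟩

theorem supp_subset_of_mem_iterate_map_singleton {n : ℕ} {σ τ : Tile d M}
    (h : σ ∈ Φ.map^[n] {τ}) : σ.supp ⊆ Φ.ratio ^ n • τ.supp := by
  induction n generalizing σ with
  | zero => simp_all
  | succ n ih =>
    rw [Function.iterate_succ_apply'] at h
    obtain ⟨ρ, hρ, hσ⟩ := mem_map_iff_exists.1 h
    refine (supp_subset_of_mem_map_singleton hσ).trans ?_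
    rw [pow_succ', mul_smul]
    exact smul_set_mono (ih hρ)

theorem exists_mem_iterate_map_of_mem_supp {τ : Tile d M} (hτ : Φ.IsProtoTile τ) (n : ℕ)
    {x : Space d} (hx : x ∈ τ.supp) : ∃ σ ∈ Φ.map^[n] {τ}, Φ.ratio ^ n • x ∈ σ.supp := by
  induction n with
  | zero => exact ⟨τ, by simp, by simpa using hx⟩
  | succ n ih =>
    obtain ⟨ρ, hρ, hxρ⟩ := ih
    have hρ' : Φ.IsProtoTile ρ := isProtoTile_of_mem_iterate_map (by simpa using hτ) n ρ hρ
    obtain ⟨σ, hσ, hxσ⟩ := exists_mem_map_of_mem_supp hρ' hxρ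
    refine ⟨σ, ?_, by rwa [pow_succ', mul_smul]⟩
    rw [Function.iterate_succ_apply']
    exact mem_map_iff_exists.2 ⟨ρ, hρ, hσ⟩

theorem _root_.SubstTiling.AgreeOn.map {T T' : Set (Tile d M)} {X : Set (Space d)}
    (h : AgreeOn T T' X) : AgreeOn (Φ.map T) (Φ.map T') (Φ.ratio • X) := by
  have key : ∀ {T T' : Set (Tile d M)}, AgreeOn T T' X → ∀ x ∈ X, ∀ σ : Tile d M,
      Φ.ratio • x ∈ σ.supp → σ ∈ Φ.map T → σ ∈ Φ.map T' := by
    intro T T' h x hx σ hσ h1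
    obtain ⟨τ, hτ, h2⟩ := mem_map_iff_exists.1 h1
    have h3 : x ∈ τ.supp :=
      (smul_mem_smul_set_iff₀ Φ.ratio_ne_zero _ _).1 (supp_subset_of_mem_map_singleton h2 hσ)
    exact mem_map_iff_exists.2 ⟨τ, (h.mem_iff hx h3).1 hτ, h2⟩
  rw [agreeOn_iff]
  rintro _ ⟨x, hx, rfl⟩ σ hσ
  exact ⟨key h x hx σ hσ, key h.symm x hx σ hσ⟩

theorem _root_.SubstTiling.AgreeOn.iterate_map {T T' : Set (Tile d M)} {X : Set (Space d)}
    (h : AgreeOn T T' X) (n : ℕ) :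
    AgreeOn (Φ.map^[n] T) (Φ.map^[n] T') (Φ.ratio ^ n • X) := by
  induction n with
  | zero => simpa using h
  | succ n ih =>
    rw [Function.iterate_succ_apply', Function.iterate_succ_apply', pow_succ', mul_smul]
    exact ih.map

/-! ### The tiling space -/

theorem isAllowed_vadd {P : Set (Tile d M)} (h : Φ.IsAllowed P) (w : Space d) :
    Φ.IsAllowed (w +ᵥ P) := by
  obtain ⟨m, hm, i, v, hP⟩ := h
  refine ⟨m, hm, i, v - w, ?_⟩
  rw [neg_sub, sub_eq_add_neg, add_vadd]
  exact vadd_set_mono hP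

theorem vadd_mem_tilingSpace {T : Set (Tile d M)} (hT : T ∈ Φ.tilingSpace) (w : Space d) :
    w +ᵥ T ∈ Φ.tilingSpace := by
  refine ⟨hT.1.vadd w, fun P hP hfin => ?_⟩
  have h := isAllowed_vadd (hT.2 (-w +ᵥ P) ?_ (hfin.vadd_set)) w
  · rwa [vadd_neg_vadd] at h
  · rw [← neg_vadd_vadd w T]
    exact vadd_set_mono hP

theorem isProtoTile_of_mem {T : Set (Tile d M)} (hT : T ∈ Φ.tilingSpace) {τ : Tile d M}
    (hτ : τ ∈ T) : Φ.IsProtoTile τ := by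
  obtain ⟨m, hm, i, v, hP⟩ := hT.2 {τ} (by simpa using hτ) (finite_singleton τ)
  have h := mem_vadd_iff.1 (singleton_subset_iff.1 hP)
  have h2 := isProtoTile_of_mem_iterate_map
    (P := {Φ.proto i}) (by simpa using isProtoTile_proto i) m _ h
  simpa using h2.vadd (-v)

theorem map_mem_tilingSpace {T : Set (Tile d M)} (hT : T ∈ Φ.tilingSpace) :
    Φ.map T ∈ Φ.tilingSpace := by
  refine ⟨isTiling_map hT.1 fun τ hτ => isProtoTile_of_mem hT hτ, fun P hP hfin => ?_⟩
  have h1 : ∀ σ ∈ P, ∃ τ ∈ T, σ ∈ Φ.map {τ} := fun σ hσ => mem_map_iff_exists.1 (hP hσ)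
  choose! f hf hf' using h1
  obtain ⟨m, hm, i, v, hQ⟩ := hT.2 (f '' P) (by rintro _ ⟨σ, hσ, rfl⟩; exact hf σ hσ)
    (hfin.image f)
  refine ⟨m + 1, by omega, i, Φ.ratio • v, fun σ hσ => ?_⟩
  rw [Function.iterate_succ_apply', ← smul_neg, ← map_vadd]
  exact map_mono hQ (mem_map_iff_exists.2 ⟨f σ, mem_image_of_mem f hσ, hf' σ hσ⟩)

theorem iterate_map_mem_tilingSpace {T : Set (Tile d M)} (hT : T ∈ Φ.tilingSpace) (n : ℕ) :
    Φ.map^[n] T ∈ Φ.tilingSpace := by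
  induction n with
  | zero => exact hT
  | succ n ih =>
    rw [Function.iterate_succ_apply']
    exact map_mem_tilingSpace ih

/-! ### Sizes of tiles and local finiteness -/

variable (Φ) in
theorem exists_diam_bound : ∃ D : ℝ, 0 < D ∧ ∀ τ, Φ.IsProtoTile τ →
    ∀ x ∈ τ.supp, ∀ y ∈ τ.supp, dist x y ≤ D := by
  have h : ∀ i, ∃ D : ℝ, ∀ x ∈ (Φ.proto i).supp, ∀ y ∈ (Φ.proto i).supp, dist x y ≤ D := fun i =>
    (Metric.isBounded_iff.1 (Φ.proto i).isCompact.isBounded).imp fun D hD x hx y hy => hD hx hy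
  choose D hD using h
  refine ⟨∑ i, |D i| + 1, by positivity, ?_⟩
  rintro _ ⟨i, v, rfl⟩ x hx y hy
  have h1 := hD i _ (Tile.mem_vadd_supp.1 hx) _ (Tile.mem_vadd_supp.1 hy)
  rw [dist_sub_right] at h1
  have h2 := Finset.single_le_sum (f := fun i => |D i|) (fun _ _ => abs_nonneg _)
    (Finset.mem_univ i)
  have h3 := le_abs_self (D i)
  linarith

variable (Φ) in
theorem exists_inradius : ∃ r : ℝ, 0 < r ∧ ∀ τ, Φ.IsProtoTile τ →
    ∃ c, Metric.ball c r ⊆ τ.supp := by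
  have h : ∀ i, ∃ c, ∀ᶠ r in 𝓝[>] (0 : ℝ), Metric.ball c r ⊆ (Φ.proto i).supp := by
    intro i
    obtain ⟨c, hc⟩ := (Φ.proto i).interior_nonempty
    obtain ⟨r, hr, h⟩ := Metric.mem_nhds_iff.1 (mem_interior_iff_mem_nhds.1 hc)
    refine ⟨c, ?_⟩
    filter_upwards [Ioo_mem_nhdsGT hr] with s hs
    exact (Metric.ball_subset_ball hs.2.le).trans h
  choose c hc using h
  obtain ⟨r, hr, hr0⟩ := ((eventually_all.2 hc).and self_mem_nhdsWithin).exists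
  refine ⟨r, hr0, ?_⟩
  rintro _ ⟨i, v, rfl⟩
  refine ⟨c i + v, fun x hx => Tile.mem_vadd_supp.2 (hr i ?_)⟩
  rw [Metric.mem_ball, dist_eq_norm] at hx ⊢
  rwa [sub_sub, add_comm v]

/-- Every tile contains a ball of a fixed radius, so the centres of distinct tiles are separated,
while the centres in question stay in a bounded region. -/
theorem finite_of_isPatch {P : Set (Tile d M)} (hP : IsPatch P) (hp : ∀ τ ∈ P, Φ.IsProtoTile τ)
    {s : Set (Space d)} (hs : Bornology.IsBounded s) :
    {τ ∈ P | (s ∩ τ.supp).Nonempty}.Finite := by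
  obtain ⟨D, hD, hdiam⟩ := Φ.exists_diam_bound
  obtain ⟨r, hr, hin⟩ := Φ.exists_inradius
  choose! c hc using hin
  have htb : TotallyBounded (Metric.thickening (D + 1) s) :=
    (Metric.isCompact_of_isClosed_isBounded isClosed_closure
      hs.thickening.closure).totallyBounded.subset subset_closure
  obtain ⟨t, ht, htc⟩ := Metric.totallyBounded_iff.1 htb (r / 2) (by linarith)
  have hcτ : ∀ τ ∈ P, c τ ∈ τ.supp := fun τ hτ => hc τ (hp τ hτ) (Metric.mem_ball_self hr)
  refine (ht.biUnion (t := fun y => {τ ∈ P | c τ ∈ Metric.ball y (r / 2)}) ?_).subset ?_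
  · intro y _
    refine Set.Subsingleton.finite ?_
    rintro σ ⟨hσ, hσy⟩ τ ⟨hτ, hτy⟩
    refine hP.eq_of_mem_interior hσ hτ (x := c τ) ?_ (hcτ τ hτ)
    refine interior_maximal (hc σ (hp σ hσ)) Metric.isOpen_ball ?_
    rw [Metric.mem_ball] at hσy hτy ⊢
    linarith [dist_triangle_right (c τ) (c σ) y]
  · rintro τ ⟨hτ, x, hxs, hx⟩
    have h1 : c τ ∈ Metric.thickening (D + 1) s := by
      refine Metric.mem_thickening_iff.2 ⟨x, hxs, ?_⟩
      linarith [hdiam τ (hp τ hτ) _ (hcτ τ hτ) _ hx]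
    obtain ⟨y, hy, hy'⟩ := mem_iUnion₂.1 (htc h1)
    exact mem_iUnion₂.2 ⟨y, hy, hτ, hy'⟩

variable (Φ) in
theorem rule_finite (i : Fin Φ.card) : (Φ.rule i).Finite := by
  refine (finite_of_isPatch (Φ := Φ) (Φ.rule_isPatch i) (fun τ hτ => ?_)
    ((Φ.proto i).isCompact.smul Φ.ratio).isBounded).subset (fun τ hτ => ⟨hτ, ?_⟩)
  · obtain ⟨j, v, rfl⟩ := Φ.rule_translate i τ hτ
    exact isProtoTile_vadd_proto v j
  · obtain ⟨x, hx⟩ := τ.nonempty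
    refine ⟨x, ?_, hx⟩
    rw [← Φ.rule_support]
    exact mem_support.2 ⟨τ, hτ, hx⟩

theorem finite_of_mem_tilingSpace {T : Set (Tile d M)} (hT : T ∈ Φ.tilingSpace)
    {s : Set (Space d)} (hs : Bornology.IsBounded s) :
    {τ ∈ T | (s ∩ τ.supp).Nonempty}.Finite :=
  finite_of_isPatch hT.1.1 (fun _ hτ => isProtoTile_of_mem hT hτ) hs

variable (Φ) in
-- A translation shorter than the inradius makes a tile overlap its translate. In `stablyEquiv_iff`
-- this determines a small translation vector uniquely.
theorem exists_separation : ∃ r : ℝ, 0 < r ∧ ∀ P : Set (Tile d M), IsPatch P →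
    ∀ τ, Φ.IsProtoTile τ → ∀ v w : Space d, v +ᵥ τ ∈ P → w +ᵥ τ ∈ P → ‖v - w‖ < r → v = w := by
  obtain ⟨r, hr, hin⟩ := Φ.exists_inradius
  refine ⟨r, hr, fun P hP τ hτ v w hv hw hvw => ?_⟩
  obtain ⟨c, hc⟩ := hin _ (hτ.vadd v)
  refine Tile.eq_of_vadd_eq (hP.eq_of_mem_interior hv hw (x := c - v + w)
    (interior_maximal hc Metric.isOpen_ball ?_) ?_)
  · rw [Metric.mem_ball, dist_eq_norm]
    convert hvw using 1
    rw [← norm_neg]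
    congr 1
    abel
  · rw [Tile.mem_vadd_supp, add_sub_cancel_right]
    exact Tile.mem_vadd_supp.1 (hc (Metric.mem_ball_self hr))

/-- Agreement at a point extends to a neighbourhood of that point. -/
theorem exists_ball_agreeOn {T T' : Set (Tile d M)} (hT : T ∈ Φ.tilingSpace)
    (hT' : T' ∈ Φ.tilingSpace) {x : Space d} (h : AgreeOn T T' {x}) :
    ∃ r : ℝ, 0 < r ∧ AgreeOn T T' (Metric.ball x r) := by
  -- By local finiteness, no tile appears near `x` that does not already contain `x`.
  have key : ∀ {T : Set (Tile d M)}, T ∈ Φ.tilingSpace →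
      ∀ᶠ y in 𝓝 x, ∀ τ ∈ T, y ∈ τ.supp → x ∈ τ.supp := by
    intro T hT
    have hfin := finite_of_mem_tilingSpace hT (Metric.isBounded_ball (x := x) (r := 1))
    have h1 : ∀ᶠ y in 𝓝 x, ∀ τ ∈ {τ ∈ T | (Metric.ball x 1 ∩ τ.supp).Nonempty},
        y ∈ τ.supp → x ∈ τ.supp := by
      refine (eventually_all_finite hfin).2 fun τ _ => ?_
      by_cases hx : x ∈ τ.supp
      · exact Eventually.of_forall fun _ _ => hx
      · filter_upwards [τ.isCompact.isClosed.isOpen_compl.mem_nhds hx] with y hy hy'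
        exact absurd hy' hy
    filter_upwards [h1, Metric.ball_mem_nhds x one_pos] with y hy hyb τ hτ hyτ
    exact hy τ ⟨hτ, y, hyb, hyτ⟩ hyτ
  obtain ⟨r, hr, hball⟩ := Metric.eventually_nhds_iff.1 ((key hT).and (key hT'))
  refine ⟨r, hr, agreeOn_iff.2 fun y hy τ hτ => ?_⟩
  obtain ⟨h1, h2⟩ := hball (Metric.mem_ball.1 hy)
  have hx : x ∈ ({x} : Set (Space d)) := rfl
  exact ⟨fun h' => (h.mem_iff hx (h1 τ h' hτ)).1 h', fun h' => (h.mem_iff hx (h2 τ h' hτ)).2 h'⟩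

end SelfSimilarSubstitution

/-! ### Ultrafilter limits: surjectivity of the substitution and compactness. -/

theorem exists_eventually_of_finite {ι β : Type*} {𝒰 : Ultrafilter ι} {F : Set β} (hF : F.Finite)
    {p : ι → β → Prop} (h : ∀ᶠ k in (𝒰 : Filter ι), ∃ q ∈ F, p k q) :
    ∃ q ∈ F, ∀ᶠ k in (𝒰 : Filter ι), p k q := by
  refine (Ultrafilter.finite_biUnion_mem_iff (s := fun q => {k | p k q}) hF).1 ?_
  filter_upwards [h] with k hk
  simpa using hk

/-- The tiles of `T` that meet the ball of radius `R` about `x`. -/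
def patchAt (T : Set (Tile d M)) (x : Space d) (R : ℝ) : Set (Tile d M) :=
  {τ ∈ T | (Metric.ball x R ∩ τ.supp).Nonempty}

theorem agreeOn_ball_iff {T T' : Set (Tile d M)} {x : Space d} {R : ℝ} :
    AgreeOn T T' (Metric.ball x R) ↔ patchAt T x R = patchAt T' x R := by
  constructor
  · intro h
    ext τ
    constructor
    · rintro ⟨hτ, y, hy, hyτ⟩
      exact ⟨(h.mem_iff hy hyτ).1 hτ, y, hy, hyτ⟩
    · rintro ⟨hτ, y, hy, hyτ⟩
      exact ⟨(h.mem_iff hy hyτ).2 hτ, y, hy, hyτ⟩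
  · refine fun h => agreeOn_iff.2 fun y hy τ hτ => ?_
    have hmem : ∀ A : Set (Tile d M), τ ∈ A ↔ τ ∈ patchAt A x R := fun A =>
      ⟨fun h' => ⟨h', y, hy, hτ⟩, fun h' => h'.1⟩
    rw [hmem T, hmem T', h]

theorem agreeOn_ball_zero_iff {T T' : Set (Tile d M)} {R : ℝ} :
    AgreeOn T T' (Metric.ball 0 R) ↔ ballPatch R T = ballPatch R T' := agreeOn_ball_iff

namespace SelfSimilarSubstitution

variable {Φ : SelfSimilarSubstitution d M}

/-- By finite local complexity, the patches cut out by balls of a given radius are, up to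
translation, in a finite list. -/
theorem exists_finite_patches (hFLC : HasFLC Φ.tilingSpace) (R : ℝ) :
    ∃ F : Set (Set (Tile d M)), F.Finite ∧ ∀ T ∈ Φ.tilingSpace, ∀ x,
      ∃ Q ∈ F, ∃ v : Space d, patchAt T x R = v +ᵥ Q := by
  obtain ⟨D, hD, hdiam⟩ := Φ.exists_diam_bound
  obtain ⟨F, hF, h⟩ := hFLC (2 * R + 2 * D)
  refine ⟨F, hF, fun T hT x => h T hT _ (fun τ hτ => hτ.1) ?_⟩
  refine Metric.ediam_le fun y hy z hz => ?_
  obtain ⟨σ, ⟨hσ, a, ha, haσ⟩, hyσ⟩ := mem_support.1 hy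
  obtain ⟨τ, ⟨hτ, b, hb, hbτ⟩, hzτ⟩ := mem_support.1 hz
  rw [edist_dist]
  refine ENNReal.ofReal_le_ofReal ?_
  have h1 := hdiam σ (isProtoTile_of_mem hT hσ) y hyσ a haσ
  have h2 := hdiam τ (isProtoTile_of_mem hT hτ) b hbτ z hzτ
  rw [Metric.mem_ball] at ha hb
  linarith [dist_triangle4 y a b z, dist_triangle_right a b x]

/-- Finiteness allows the parent of a tile to be chosen constant along an ultrafilter. -/
theorem finite_predecessors (σ : Tile d M) : {τ | σ ∈ Φ.map {τ}}.Finite := by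
  have h : ∀ i, (⋃ ρ ∈ Φ.rule i, {τ : Tile d M | ∃ v : Space d, τ = v +ᵥ Φ.proto i ∧
      σ = (Φ.ratio • v) +ᵥ ρ}).Finite := by
    refine fun i => (Φ.rule_finite i).biUnion fun ρ _ => Set.Subsingleton.finite ?_
    rintro _ ⟨v, rfl, h⟩ _ ⟨w, rfl, h'⟩
    rw [h] at h'
    rw [smul_right_injective _ Φ.ratio_ne_zero (Tile.eq_of_vadd_eq h')]
  refine (finite_iUnion h).subset fun τ hτ => ?_
  obtain ⟨i, v, h1, ρ, hρ, h2⟩ := mem_map.1 hτ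
  exact mem_iUnion.2 ⟨i, mem_iUnion₂.2 ⟨ρ, hρ, v, h1.symm, h2.symm⟩⟩

/-- The substitution maps `Ω_Φ` onto itself. -/
theorem exists_map_eq [Nontrivial (Space d)] {T : Set (Tile d M)} (hT : T ∈ Φ.tilingSpace) :
    ∃ S ∈ Φ.tilingSpace, Φ.map S = T := by
  obtain ⟨D, hD, hdiam⟩ := Φ.exists_diam_bound
  -- The patch lies in a translate of `Φ^(m+1)(proto i)`, and `Q` is the matching translate of
  -- `Φ^m(proto i)`. If `m = 0`, the patch fits into one inflated prototile, of diameter at most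
  -- `ratio * D`; large `k` excludes this, so `Q` is allowed.
  have h0 : ∀ k : ℕ, ∃ Q : Set (Tile d M), IsPatch Q ∧ (∀ τ ∈ Q, Φ.IsProtoTile τ) ∧
      patchAt T 0 k ⊆ Φ.map Q ∧ (Φ.ratio * D < k → ∀ P ⊆ Q, Φ.IsAllowed P) := by
    intro k
    obtain ⟨m, hm, i, v, hP⟩ := hT.2 (patchAt T 0 k) (fun τ hτ => hτ.1)
      (finite_of_mem_tilingSpace hT Metric.isBounded_ball)
    obtain ⟨m, rfl⟩ := Nat.exists_eq_add_of_le' hm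
    rw [Function.iterate_succ_apply'] at hP
    have hpr : ∀ τ ∈ ({Φ.proto i} : Set (Tile d M)), Φ.IsProtoTile τ := by
      rintro τ rfl
      exact isProtoTile_proto i
    refine ⟨-(Φ.ratio⁻¹ • v) +ᵥ Φ.map^[m] {Φ.proto i}, ?_, ?_, ?_, fun hk P hPQ => ?_⟩
    · exact (isPatch_iterate_map (Set.pairwiseDisjoint_singleton _ _) m).vadd _
    · rintro _ ⟨τ, hτ, rfl⟩
      exact (isProtoTile_of_mem_iterate_map hpr m τ hτ).vadd _
    · rwa [map_vadd, smul_neg, smul_inv_smul₀ Φ.ratio_ne_zero]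
    · refine ⟨m, Nat.one_le_iff_ne_zero.2 ?_, i, Φ.ratio⁻¹ • v, hPQ⟩
      rintro rfl
      have hk0 : (0 : ℝ) < k := (mul_pos Φ.ratio_pos hD).trans hk
      have key : ∀ x : Space d, ‖x‖ < k → Φ.ratio⁻¹ • (x + v) ∈ (Φ.proto i).supp := by
        intro x hx
        obtain ⟨σ, hσ, hxσ⟩ := hT.1.exists_mem x
        have h1 := hP ⟨hσ, x, by simpa using hx, hxσ⟩
        rw [mem_vadd_iff, neg_neg] at h1
        have h2 := supp_subset_of_mem_map_singleton h1
          (show x + v ∈ (v +ᵥ σ).supp by rw [Tile.mem_vadd_supp]; simpa using hxσ)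
        exact (mem_smul_set_iff_inv_smul_mem₀ Φ.ratio_ne_zero _ _).1 h2
      obtain ⟨x, hx1, hx2⟩ := exists_between hk
      obtain ⟨e, he⟩ := NormedSpace.exists_lt_norm ℝ (Space d) 0
      set y : Space d := (x / ‖e‖) • e
      have hx0 : 0 < x := (mul_pos Φ.ratio_pos hD).trans hx1
      have hy : ‖y‖ = x := by
        rw [norm_smul, norm_div, norm_norm, div_mul_cancel₀ _ he.ne', Real.norm_of_nonneg hx0.le]
      have h1 := hdiam _ (isProtoTile_proto i) _ (key y (by rwa [hy])) _ (key 0 (by simpa using hk0))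
      rw [dist_smul₀, dist_add_right, dist_zero_right, hy, norm_inv,
        Real.norm_of_nonneg Φ.ratio_pos.le, inv_mul_le_iff₀ Φ.ratio_pos] at h1
      linarith
  choose Q hQpatch hQproto hQmap hQall using h0
  set 𝒰 : Ultrafilter ℕ := hyperfilter ℕ
  have h𝒰 : (𝒰 : Filter ℕ) ≤ atTop := Nat.hyperfilter_le_atTop
  set S : Set (Tile d M) := {τ | ∀ᶠ k in (𝒰 : Filter ℕ), τ ∈ Q k} with hS
  have hlarge : ∀ a : ℝ, ∀ᶠ k : ℕ in (𝒰 : Filter ℕ), a < k := fun a =>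
    h𝒰 (tendsto_natCast_atTop_atTop.eventually_gt_atTop a)
  have hTS : T ⊆ Φ.map S := by
    intro σ hσ
    obtain ⟨x, hx⟩ := σ.nonempty
    obtain ⟨τ, hτ, h⟩ := exists_eventually_of_finite (𝒰 := 𝒰)
      (p := fun k τ => τ ∈ Q k) (finite_predecessors (Φ := Φ) σ) (by
        filter_upwards [hlarge ‖x‖] with k hk
        obtain ⟨τ, h1, h2⟩ := mem_map_iff_exists.1 (hQmap k ⟨hσ, x, by simpa using hk, hx⟩)
        exact ⟨τ, h2, h1⟩)
    exact mem_map_iff_exists.2 ⟨τ, h, hτ⟩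
  have hSpatch : IsPatch S := by
    intro σ hσ τ hτ hne
    obtain ⟨k, h1, h2⟩ := (Eventually.and (show ∀ᶠ k in (𝒰 : Filter ℕ), σ ∈ Q k from hσ)
      (show ∀ᶠ k in (𝒰 : Filter ℕ), τ ∈ Q k from hτ)).exists
    exact hQpatch k h1 h2 hne
  refine ⟨S, ⟨isTiling_iff.2 ⟨hSpatch, fun x => ?_⟩, fun P hP hfin => ?_⟩,
    (hT.1.eq_of_subset (isPatch_map hSpatch) hTS).symm⟩
  · obtain ⟨σ, hσ, hx⟩ := hT.1.exists_mem (Φ.ratio • x)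
    obtain ⟨τ, hτ, h⟩ := mem_map_iff_exists.1 (hTS hσ)
    exact ⟨τ, hτ, (smul_mem_smul_set_iff₀ Φ.ratio_ne_zero _ _).1
      (supp_subset_of_mem_map_singleton h hx)⟩
  · obtain ⟨k, h1, h2⟩ := (((eventually_all_finite hfin).2 fun τ hτ => hP hτ).and
      (hlarge (Φ.ratio * D))).exists
    exact hQall k h2 P h1

theorem exists_iterate_map_eq [Nontrivial (Space d)] {T : Set (Tile d M)}
    (hT : T ∈ Φ.tilingSpace) (n : ℕ) : ∃ S ∈ Φ.tilingSpace, Φ.map^[n] S = T := by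
  induction n with
  | zero => exact ⟨T, hT, rfl⟩
  | succ n ih =>
    obtain ⟨S, hS, h⟩ := ih
    obtain ⟨S', hS', h'⟩ := exists_map_eq hS
    exact ⟨S', hS', by rw [Function.iterate_succ_apply, h', h]⟩

/-- Compactness of `Ω_Φ`: along an ultrafilter, every family of tilings of `Ω_Φ` converges to a
tiling of `Ω_Φ`, up to translations that tend to `0`. -/
theorem exists_limit (hFLC : HasFLC Φ.tilingSpace) {ι : Type*} (𝒰 : Ultrafilter ι)
    {S : ι → Set (Tile d M)} (hS : ∀ k, S k ∈ Φ.tilingSpace) :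
    ∃ A ∈ Φ.tilingSpace, ∃ v : ι → Space d, Tendsto v 𝒰 (𝓝 0) ∧
      ∀ R : ℝ, ∀ᶠ k in (𝒰 : Filter ι), AgreeOn (S k) (v k +ᵥ A) (Metric.ball 0 R) := by
  have h1 : ∀ k, ∃ (i : Fin Φ.card) (b : Space d), b +ᵥ Φ.proto i ∈ S k ∧
      -b ∈ (Φ.proto i).supp := by
    intro k
    obtain ⟨τ, hτ, h0⟩ := (hS k).1.exists_mem 0
    obtain ⟨i, b, rfl⟩ := isProtoTile_of_mem (hS k) hτ
    exact ⟨i, b, hτ, by simpa [Tile.mem_vadd_supp] using h0⟩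
  choose i b hb hb0 using h1
  obtain ⟨j, -, hj⟩ := exists_eventually_of_finite (𝒰 := 𝒰) (p := fun k j => i k = j)
    (finite_univ (α := Fin Φ.card)) (Eventually.of_forall fun k => ⟨i k, mem_univ _, rfl⟩)
  obtain ⟨c, -, hc⟩ := (Φ.proto j).isCompact.ultrafilter_le_nhds (𝒰.map fun k => -b k) (by
    rw [le_principal_iff]
    change ∀ᶠ k in (𝒰 : Filter ι), -b k ∈ (Φ.proto j).supp
    filter_upwards [hj] with k hk
    exact hk ▸ hb0 k)
  have hbc : Tendsto b 𝒰 (𝓝 (-c)) := by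
    have h2 : Tendsto (fun k => -b k) 𝒰 (𝓝 c) := hc
    simpa using h2.neg
  -- After recentring, `proto j` itself belongs to almost every tiling, so convergence to `A₀` needs
  -- no further shift.
  set A₀ : Set (Tile d M) := {τ | ∀ᶠ k in (𝒰 : Filter ι), τ ∈ -b k +ᵥ S k}
  obtain ⟨p, hp⟩ := (Φ.proto j).nonempty
  have hagree : ∀ R : ℝ, ∀ᶠ k in (𝒰 : Filter ι),
      AgreeOn (-b k +ᵥ S k) A₀ (Metric.ball 0 R) := by
    intro R₀
    -- Large enough for `proto j`, which contains `p`, to belong to the patch.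
    set R := max R₀ (‖p‖ + 1)
    have hpR : p ∈ Metric.ball (0 : Space d) R := by
      rw [mem_ball_zero_iff]
      exact (lt_add_one _).trans_le (le_max_right _ _)
    obtain ⟨F, hF, hFp⟩ := exists_finite_patches hFLC R
    obtain ⟨Q, -, hQ⟩ := exists_eventually_of_finite (𝒰 := 𝒰) hF
      (Eventually.of_forall fun k => hFp _ (vadd_mem_tilingSpace (hS k) (-b k)) 0)
    have hQfin : Q.Finite := by
      obtain ⟨k, w, hw⟩ := hQ.exists
      have h2 : (patchAt (-b k +ᵥ S k) 0 R).Finite :=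
        finite_of_mem_tilingSpace (vadd_mem_tilingSpace (hS k) (-b k)) Metric.isBounded_ball
      rw [hw] at h2
      exact (Set.finite_vadd_set).1 h2
    -- Finite local complexity gives the patch only up to translation. The tile of `Q` carried to
    -- `proto j` determines that translation, and it has finitely many candidates.
    obtain ⟨σ, -, hσ⟩ := exists_eventually_of_finite (𝒰 := 𝒰) hQfin
      (p := fun k σ => ∃ w : Space d, patchAt (-b k +ᵥ S k) 0 R = w +ᵥ Q ∧
        -w +ᵥ Φ.proto j = σ) (by
        filter_upwards [hQ, hj] with k hk hjk
        obtain ⟨w, hw⟩ := hk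
        refine ⟨_, ?_, w, hw, rfl⟩
        rw [← mem_vadd_iff, ← hw]
        refine ⟨?_, p, hpR, hp⟩
        rw [mem_vadd_iff, neg_neg]
        exact hjk ▸ hb k)
    obtain ⟨k₀, w₀, -, hw₀⟩ := hσ.exists
    have hconst : ∀ᶠ k in (𝒰 : Filter ι), patchAt (-b k +ᵥ S k) 0 R = w₀ +ᵥ Q := by
      filter_upwards [hσ] with k hk
      obtain ⟨w, hw, hwσ⟩ := hk
      rw [hw, neg_injective (Tile.eq_of_vadd_eq (hwσ.trans hw₀.symm))]
    have hA₀ : patchAt A₀ 0 R = w₀ +ᵥ Q := by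
      ext τ
      constructor
      · rintro ⟨hτ, hτR⟩
        obtain ⟨k, hk, hk'⟩ := (hconst.and (show ∀ᶠ k in (𝒰 : Filter ι), τ ∈ -b k +ᵥ S k
          from hτ)).exists
        rw [← hk]
        exact ⟨hk', hτR⟩
      · intro hτ
        obtain ⟨k, hk⟩ := hconst.exists
        refine ⟨?_, (hk ▸ hτ : τ ∈ patchAt (-b k +ᵥ S k) 0 R).2⟩
        change ∀ᶠ k in (𝒰 : Filter ι), τ ∈ -b k +ᵥ S k
        filter_upwards [hconst] with k hk
        exact (hk ▸ hτ : τ ∈ patchAt (-b k +ᵥ S k) 0 R).1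
    filter_upwards [hconst] with k hk
    exact (agreeOn_ball_iff.2 (hk.trans hA₀.symm)).mono
      (Metric.ball_subset_ball (le_max_left _ _))
  have hA₀mem : A₀ ∈ Φ.tilingSpace := by
    refine ⟨isTiling_iff.2 ⟨fun σ hσ τ hτ hne => ?_, fun x => ?_⟩, fun P hP hfin => ?_⟩
    · obtain ⟨k, h2, h3⟩ := (Eventually.and (show ∀ᶠ k in (𝒰 : Filter ι), σ ∈ -b k +ᵥ S k from hσ)
        (show ∀ᶠ k in (𝒰 : Filter ι), τ ∈ -b k +ᵥ S k from hτ)).exists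
      exact (hS k).1.1.vadd _ h2 h3 hne
    · obtain ⟨k, hk⟩ := (hagree (‖x‖ + 1)).exists
      obtain ⟨τ, hτ, hx⟩ := ((hS k).1.vadd (-b k)).exists_mem x
      exact ⟨τ, (hk.mem_iff (by simp) hx).1 hτ, hx⟩
    · obtain ⟨k, hk⟩ := ((eventually_all_finite hfin).2 fun τ hτ => hP hτ).exists
      exact (vadd_mem_tilingSpace (hS k) (-b k)).2 P hk hfin
  refine ⟨-c +ᵥ A₀, vadd_mem_tilingSpace hA₀mem _, fun k => b k + c, ?_, fun R => ?_⟩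
  · simpa using hbc.add_const c
  · have h2 : ∀ᶠ k in (𝒰 : Filter ι), ‖b k‖ < ‖-c‖ + 1 :=
      (hbc.norm).eventually_lt_const (lt_add_one _)
    filter_upwards [h2, hagree (R + (‖-c‖ + 1))] with k hk hk'
    have h3 := hk'.vadd (b k)
    rw [vadd_neg_vadd] at h3
    rw [vadd_vadd, add_neg_cancel_right]
    refine h3.mono fun x hx => ?_
    rw [mem_vadd_set_iff_neg_vadd_mem, vadd_eq_add, mem_ball_zero_iff]
    rw [mem_ball_zero_iff] at hx
    linarith [norm_add_le (-b k) x, norm_neg (b k)]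

end SelfSimilarSubstitution

/-! ### Recurrent prototiles and repulsion. -/

theorem exists_iterate_idempotent {α : Type*} [Finite α] (f : α → α) :
    ∃ p : ℕ, 1 ≤ p ∧ ∀ s i, f^[p] (f^[p + s] i) = f^[p + s] i := by
  obtain ⟨a, b, hab, h⟩ : ∃ a b : ℕ, a < b ∧ f^[a] = f^[b] := by
    obtain ⟨a, b, hne, h⟩ := Finite.exists_ne_map_eq_of_infinite fun n : ℕ => f^[n]
    rcases lt_or_gt_of_ne hne with hlt | hlt
    · exact ⟨a, b, hlt, h⟩
    · exact ⟨b, a, hlt, h.symm⟩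
  have h1 : ∀ n, a ≤ n → f^[n + (b - a)] = f^[n] := by
    intro n hn
    obtain ⟨m, rfl⟩ := Nat.exists_eq_add_of_le' hn
    rw [show m + a + (b - a) = m + b by omega, Function.iterate_add, ← h, ← Function.iterate_add]
  have h2 : ∀ k n, a ≤ n → f^[n + k * (b - a)] = f^[n] := by
    intro k
    induction k with
    | zero => simp
    | succ k ih =>
      intro n hn
      rw [add_mul, one_mul, ← add_assoc, h1 _ (by omega), ih n hn]
  have hp : a + 1 ≤ (a + 1) * (b - a) := Nat.le_mul_of_pos_right _ (by omega)
  -- A multiple of the period `b - a` that is at least the preperiod `a`; the `+ 1` keeps it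
  -- positive.
  refine ⟨(a + 1) * (b - a), by omega, fun s i => ?_⟩
  rw [← Function.iterate_add_apply, add_comm, h2 _ _ (by omega)]

namespace SelfSimilarSubstitution

variable {Φ : SelfSimilarSubstitution d M}

/-- If a translate of `proto i` occurs in `Φ^p(proto i)`, then `Φ^(p k)(proto i)` occurs in
`Φ^(p l)(proto i)` for `k ≤ l`. -/
theorem exists_vadd_iterate_map_subset {i : Fin Φ.card} {p : ℕ} {a : Space d}
    (ha : a +ᵥ Φ.proto i ∈ Φ.map^[p] {Φ.proto i}) {k l : ℕ} (hkl : k ≤ l) :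
    ∃ g : Space d, g +ᵥ Φ.map^[p * k] {Φ.proto i} ⊆ Φ.map^[p * l] {Φ.proto i} := by
  induction l, hkl using Nat.le_induction with
  | base => exact ⟨0, by simp⟩
  | succ l _ ih =>
    obtain ⟨g, hg⟩ := ih
    refine ⟨Φ.ratio ^ (p * l) • a + g, ?_⟩
    rw [add_vadd]
    refine (vadd_set_mono hg).trans ?_
    rw [← iterate_map_vadd, mul_add, mul_one, Function.iterate_add_apply]
    refine iterate_map_mono _ ?_
    rwa [vadd_set_singleton, singleton_subset_iff]

/-- If `proto i` recurs in its own iterates and occurs in `Ω_Φ`, there is a tiling in `Ω_Φ` all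
of whose local patches of a given size are found in a single iterate of `proto i`. -/
theorem exists_tiling_patches_subset (hFLC : HasFLC Φ.tilingSpace) {i : Fin Φ.card} {p : ℕ}
    (hp : 1 ≤ p) {a : Space d} (ha : a +ᵥ Φ.proto i ∈ Φ.map^[p] {Φ.proto i})
    {B : Set (Tile d M)} (hB : B ∈ Φ.tilingSpace) {b : Space d} (hb : b +ᵥ Φ.proto i ∈ B) :
    ∃ A ∈ Φ.tilingSpace, ∀ R : ℝ, ∃ k : ℕ, ∀ x, ∃ g : Space d,
      patchAt A x R ⊆ g +ᵥ Φ.map^[p * k] {Φ.proto i} := by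
  obtain ⟨D, hD, hdiam⟩ := Φ.exists_diam_bound
  obtain ⟨ρ, hρ, hin⟩ := Φ.exists_inradius
  have hbp := isProtoTile_vadd_proto b i
  obtain ⟨c, hc⟩ := hin _ hbp
  set 𝒰 : Ultrafilter ℕ := hyperfilter ℕ
  have h𝒰 : (𝒰 : Filter ℕ) ≤ atTop := Nat.hyperfilter_le_atTop
  -- The recentring point `c` is the centre of a ball inside the tile `b +ᵥ proto i`, whose
  -- inflations therefore exhaust space: each patch of the limit lies in one iterate of that tile.
  obtain ⟨A, hA, v, hv, hlim⟩ := exists_limit hFLC 𝒰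
    (S := fun k => -(Φ.ratio ^ (p * k) • c) +ᵥ Φ.map^[p * k] B)
    (fun k => vadd_mem_tilingSpace (iterate_map_mem_tilingSpace hB _) _)
  have hone : ∀ x R, ∃ (k : ℕ) (g : Space d),
      patchAt A x R ⊆ g +ᵥ Φ.map^[p * k] {Φ.proto i} := by
    intro x R
    have h1 : ∀ᶠ k in (𝒰 : Filter ℕ), ‖v k‖ < 1 :=
      (hv.norm).eventually_lt_const (by simp)
    have h2 : ∀ᶠ k : ℕ in (𝒰 : Filter ℕ), ‖x‖ + R + 1 + D < Φ.ratio ^ (p * k) * ρ := by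
      have h3 : Tendsto (fun k : ℕ => p * k) atTop atTop :=
        tendsto_id.const_mul_atTop' (by omega)
      exact h𝒰 (((Φ.tendsto_ratio_pow.comp h3).atTop_mul_const hρ).eventually_gt_atTop _)
    obtain ⟨k, ⟨hk1, hk2⟩, hk3⟩ := ((h1.and h2).and (hlim (‖x‖ + R + 1))).exists
    set s : ℝ := Φ.ratio ^ (p * k)
    have hs : 0 < s := pow_pos Φ.ratio_pos _
    set e : Space d := s • c + v k with he
    have hsub : patchAt A x R ⊆ -e +ᵥ Φ.map^[p * k] {b +ᵥ Φ.proto i} := by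
      rintro τ ⟨hτ, y, hy, hyτ⟩
      have hyn : ‖y‖ < ‖x‖ + R := by
        rw [mem_ball_iff_norm] at hy
        linarith [norm_sub_norm_le y x]
      have h4 : v k +ᵥ τ ∈ -(s • c) +ᵥ Φ.map^[p * k] B := by
        refine (hk3.mem_iff (x := v k + y) ?_ ?_).2 (vadd_mem_vadd_set hτ)
        · rw [mem_ball_zero_iff]
          linarith [norm_add_le (v k) y]
        · simpa [Tile.mem_vadd_supp] using hyτ
      rw [mem_vadd_iff, neg_neg, vadd_vadd, ← he] at h4
      rw [mem_vadd_iff, neg_neg]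
      obtain ⟨z, hz⟩ := τ.interior_nonempty
      have hdist := hdiam τ (isProtoTile_of_mem hA hτ) z (interior_subset hz) y hyτ
      have hz1 : s⁻¹ • (z + e) ∈ (b +ᵥ Φ.proto i).supp := by
        refine hc ?_
        rw [mem_ball_iff_norm]
        have h5 : s⁻¹ • (z + e) - c = s⁻¹ • (z + v k) := by
          rw [he, add_left_comm, smul_add, inv_smul_smul₀ hs.ne', add_sub_cancel_left]
        rw [h5, norm_smul, norm_inv, Real.norm_of_nonneg hs.le, inv_mul_lt_iff₀ hs]
        rw [dist_eq_norm] at hdist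
        have h6 : ‖z‖ ≤ ‖z - y‖ + ‖y‖ := by simpa using norm_add_le (z - y) y
        linarith [norm_add_le z (v k)]
      obtain ⟨σ, hσ, hzσ⟩ := exists_mem_iterate_map_of_mem_supp hbp (p * k) hz1
      change s • _ ∈ _ at hzσ
      rw [smul_inv_smul₀ hs.ne'] at hzσ
      have hσB : σ ∈ Φ.map^[p * k] B :=
        iterate_map_mono _ (singleton_subset_iff.2 hb) hσ
      have h7 : z + e ∈ interior (e +ᵥ τ).supp := by
        rw [Tile.vadd_supp, interior_vadd, mem_vadd_set_iff_neg_vadd_mem, vadd_eq_add]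
        convert hz using 1
        abel
      rwa [(iterate_map_mem_tilingSpace hB (p * k)).1.1.eq_of_mem_interior h4 hσB h7 hzσ]
    refine ⟨k, -e + s • b, ?_⟩
    rwa [← vadd_set_singleton, iterate_map_vadd, vadd_vadd] at hsub
  refine ⟨A, hA, fun R => ?_⟩
  obtain ⟨F, hF, hFp⟩ := exists_finite_patches hFLC R
  -- There are finitely many patches up to translation, and `exists_vadd_iterate_map_subset` allows
  -- each exponent to be raised, so one exponent serves them all.
  have hall : ∀ᶠ l : ℕ in atTop, ∀ Q ∈ F, ∀ x, ∀ w : Space d, patchAt A x R = w +ᵥ Q →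
      ∃ g : Space d, patchAt A x R ⊆ g +ᵥ Φ.map^[p * l] {Φ.proto i} := by
    refine (eventually_all_finite hF).2 fun Q _ => ?_
    by_cases hQ : ∃ x, ∃ w : Space d, patchAt A x R = w +ᵥ Q
    · obtain ⟨x, w, hx⟩ := hQ
      obtain ⟨k, g, hg⟩ := hone x R
      filter_upwards [eventually_ge_atTop k] with l hl y w' hy
      obtain ⟨g', hg'⟩ := exists_vadd_iterate_map_subset ha hl
      refine ⟨w' - w + g - g', ?_⟩
      have h1 : patchAt A y R = (w' - w) +ᵥ patchAt A x R := by
        rw [hx, hy, vadd_vadd, sub_add_cancel]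
      have h2 := vadd_set_mono (a := w' - w + g - g') hg'
      rw [vadd_vadd, sub_add_cancel, add_vadd] at h2
      rw [h1]
      exact (vadd_set_mono hg).trans h2
    · exact Eventually.of_forall fun l x w h => absurd ⟨x, w, h⟩ hQ
  obtain ⟨k, hk⟩ := hall.exists
  refine ⟨k, fun x => ?_⟩
  obtain ⟨Q, hQ, w, hw⟩ := hFp A hA x
  exact hk Q hQ x w hw

/-- Large iterates of a recurring prototile have no periods that are short relative to their
size. -/
theorem exists_repulsion_of_recurrent (hFLC : HasFLC Φ.tilingSpace)
    (hNP : NonPeriodic Φ.tilingSpace) {i : Fin Φ.card} {p : ℕ}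
    (hp : 1 ≤ p) {a : Space d} (ha : a +ᵥ Φ.proto i ∈ Φ.map^[p] {Φ.proto i})
    {B : Set (Tile d M)} (hB : B ∈ Φ.tilingSpace) {b : Space d} (hb : b +ᵥ Φ.proto i ∈ B) :
    ∃ ε : ℝ, 0 < ε ∧ ∃ k : ℕ, ∀ q, k ≤ q → ∀ G : Set (Tile d M), IsPatch G →
      ∀ h x : Space d, h +ᵥ Φ.map^[p * q] {Φ.proto i} ⊆ G → ‖x‖ < ε * Φ.ratio ^ (p * q) →
      (∀ σ ∈ h +ᵥ Φ.map^[p * q] {Φ.proto i}, -x +ᵥ σ ∈ G) → x = 0 := by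
  obtain ⟨D, hD, hdiam⟩ := Φ.exists_diam_bound
  obtain ⟨A, hA, hpatch⟩ := exists_tiling_patches_subset hFLC hp ha hB hb
  -- A ball of this radius about a point of a tile contains all points within distance `1` of the
  -- tile.
  obtain ⟨k, hk⟩ := hpatch (D + 2)
  -- With `q = k + m`, this bound makes `x` shorter than `λ^(p m)`, that is, shorter than `1` before
  -- the last `p m` inflations.
  refine ⟨(Φ.ratio ^ (p * k))⁻¹, inv_pos.2 (pow_pos Φ.ratio_pos _), k, ?_⟩
  intro q hq G hG h x hsub hx hper
  obtain ⟨m, rfl⟩ := Nat.exists_eq_add_of_le hq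
  set s : ℝ := Φ.ratio ^ (p * m) with hsdef
  have hs : 0 < s := pow_pos Φ.ratio_pos _
  have hxs : ‖x‖ < s := by
    rwa [mul_add, pow_add, inv_mul_cancel_left₀ (pow_pos Φ.ratio_pos _).ne'] at hx
  have hW := iterate_map_mem_tilingSpace hA (p * m)
  -- It suffices that `x` is a period of `Φ^(p m)(A)`. A tile `τ` of it and the tile `σ` covering a
  -- point of `-x +ᵥ τ` descend from one patch of `A`, which has a copy in `Φ^(p k)(proto i)`. In
  -- the inflated copy the assumed period forces `-x +ᵥ τ = σ`, as both occur in the patch `G`.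
  refine hNP _ hW x ((hW.1.vadd (-x)).eq_of_subset hW.1.1 ?_)
  rintro _ ⟨τ, hτ, rfl⟩
  change -x +ᵥ τ ∈ _
  obtain ⟨τ₁, hτ₁, hττ₁⟩ := mem_iterate_map_iff_exists.1 hτ
  obtain ⟨y₁, hy₁⟩ := τ₁.nonempty
  obtain ⟨g, hg⟩ := hk y₁
  have hbig : (h - s • g) +ᵥ Φ.map^[p * m] (patchAt A y₁ (D + 2)) ⊆
      h +ᵥ Φ.map^[p * (k + m)] {Φ.proto i} := by
    have h1 := vadd_set_mono (a := h - s • g) (iterate_map_mono (Φ := Φ) (p * m) hg)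
    rwa [iterate_map_vadd, vadd_vadd, sub_add_cancel, ← Function.iterate_add_apply, ← mul_add,
      add_comm m k] at h1
  set g' : Space d := h - s • g
  have hτ₁p : τ₁ ∈ patchAt A y₁ (D + 2) :=
    ⟨hτ₁, y₁, Metric.mem_ball_self (by linarith), hy₁⟩
  have hτG : -x +ᵥ (g' +ᵥ τ) ∈ G :=
    hper _ (hbig (vadd_mem_vadd_set (iterate_map_mono _ (singleton_subset_iff.2 hτ₁p) hττ₁)))
  obtain ⟨z, hz⟩ := τ.interior_nonempty
  have hz1 := supp_subset_of_mem_iterate_map_singleton hττ₁ (interior_subset hz)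
  rw [mem_smul_set_iff_inv_smul_mem₀ hs.ne'] at hz1
  obtain ⟨τ₂, hτ₂, hzτ₂⟩ := hA.1.exists_mem (s⁻¹ • (z - x))
  have hτ₂p : τ₂ ∈ patchAt A y₁ (D + 2) := by
    refine ⟨hτ₂, _, ?_, hzτ₂⟩
    have h1 := hdiam τ₁ (isProtoTile_of_mem hA hτ₁) _ hz1 _ hy₁
    rw [dist_eq_norm] at h1
    rw [mem_ball_iff_norm]
    have h2 : s⁻¹ • (z - x) - y₁ = (s⁻¹ • z - y₁) - s⁻¹ • x := by
      rw [smul_sub]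
      abel
    have h3 : ‖s⁻¹ • x‖ < 1 := by
      rw [norm_smul, norm_inv, Real.norm_of_nonneg hs.le, inv_mul_lt_iff₀ hs]
      linarith
    rw [h2]
    linarith [norm_sub_le (s⁻¹ • z - y₁) (s⁻¹ • x)]
  obtain ⟨σ, hσ, hzσ⟩ := exists_mem_iterate_map_of_mem_supp (isProtoTile_of_mem hA hτ₂) (p * m)
    hzτ₂
  rw [← hsdef, smul_inv_smul₀ hs.ne'] at hzσ
  have hσG : g' +ᵥ σ ∈ G := hsub (hbig (vadd_mem_vadd_set
    (iterate_map_mono _ (singleton_subset_iff.2 hτ₂p) hσ)))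
  have h4 : -x +ᵥ (g' +ᵥ τ) = g' +ᵥ σ := by
    refine hG.eq_of_mem_interior hτG hσG (x := g' + (z - x)) ?_ ?_
    · rw [Tile.vadd_supp, Tile.vadd_supp, interior_vadd, interior_vadd,
        mem_vadd_set_iff_neg_vadd_mem, mem_vadd_set_iff_neg_vadd_mem, vadd_eq_add, vadd_eq_add]
      convert hz using 1
      abel
    · rw [Tile.mem_vadd_supp, add_sub_cancel_left]
      exact hzσ
  rw [vadd_comm] at h4
  have h5 : -x +ᵥ τ = σ := vadd_left_cancel _ h4
  rw [h5]
  exact iterate_map_mono _ (singleton_subset_iff.2 hτ₂) hσ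

variable (Φ) in
/-- There is a self-map `f` of the prototile types such that type `f^n(i)` occurs in
`Φ^n(proto i)`. -/
theorem exists_descendant : ∃ f : Fin Φ.card → Fin Φ.card, ∀ n i,
    ∃ v : Space d, v +ᵥ Φ.proto (f^[n] i) ∈ Φ.map^[n] {Φ.proto i} := by
  have h : ∀ i, ∃ (j : Fin Φ.card) (v : Space d), v +ᵥ Φ.proto j ∈ Φ.map {Φ.proto i} := by
    intro i
    obtain ⟨x, hx⟩ := (Φ.proto i).nonempty
    obtain ⟨σ, hσ, -⟩ := exists_mem_map_of_mem_supp (isProtoTile_proto i) hx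
    obtain ⟨j, v, rfl⟩ := isProtoTile_of_mem_map hσ
    exact ⟨j, v, hσ⟩
  choose f w hw using h
  refine ⟨f, fun n i => ?_⟩
  induction n with
  | zero => exact ⟨0, by simp⟩
  | succ n ih =>
    obtain ⟨v, hv⟩ := ih
    refine ⟨Φ.ratio • v + w (f^[n] i), ?_⟩
    rw [Function.iterate_succ_apply', Function.iterate_succ_apply']
    refine mem_map_iff_exists.2 ⟨_, hv, ?_⟩
    rw [← vadd_set_singleton, map_vadd, add_vadd]
    exact vadd_mem_vadd_set (hw _)

/-- The repulsion property: for large `n`, the tiling `Φ^n(B)` does not agree with its translate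
by `λ^n δ`, `δ ≠ 0` small, on the inflation of a given ball. -/
theorem eventually_repulsion (hFLC : HasFLC Φ.tilingSpace) (hNP : NonPeriodic Φ.tilingSpace)
    {B : Set (Tile d M)} (hB : B ∈ Φ.tilingSpace) (c : Space d) {r : ℝ} (hr : 0 < r) :
    ∀ᶠ y : ℕ × Space d in atTop ×ˢ 𝓝 0,
      AgreeOn (Φ.map^[y.1] B) ((Φ.ratio ^ y.1 • y.2) +ᵥ Φ.map^[y.1] B)
        (Φ.ratio ^ y.1 • Metric.ball c r) → y.2 = 0 := by
  obtain ⟨D, hD, hdiam⟩ := Φ.exists_diam_bound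
  obtain ⟨f, hf⟩ := Φ.exists_descendant
  obtain ⟨p, hp, hfp⟩ := exists_iterate_idempotent f
  -- After `L` inflations the ball contains an entire tile.
  obtain ⟨L, hL⟩ := ((Φ.tendsto_ratio_pow.atTop_mul_const hr).eventually_gt_atTop D).exists
  obtain ⟨τ₀, hτ₀, hcτ₀⟩ :=
    (iterate_map_mem_tilingSpace hB L).1.exists_mem (Φ.ratio ^ L • c)
  have hLpos : 0 < Φ.ratio ^ L := pow_pos Φ.ratio_pos _
  have hτ₀p := isProtoTile_of_mem (iterate_map_mem_tilingSpace hB L) hτ₀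
  have hsupp : τ₀.supp ⊆ Φ.ratio ^ L • Metric.ball c r := by
    intro x hx
    rw [smul_ball hLpos.ne', Real.norm_of_nonneg hLpos.le]
    exact (hdiam τ₀ hτ₀p x hx _ hcτ₀).trans_lt hL
  obtain ⟨j, b₀, rfl⟩ := hτ₀p
  -- The type found need not recur, but for each residue `s` its descendant `f^[p + s] j` recurs
  -- after `p` steps; the levels `n` are therefore split modulo `p`.
  have hs : ∀ s : Fin p, ∀ᶠ y : ℕ × Space d in atTop ×ˢ 𝓝 0, ∀ q, y.1 = L + p + s + p * q →
      AgreeOn (Φ.map^[y.1] B) ((Φ.ratio ^ y.1 • y.2) +ᵥ Φ.map^[y.1] B)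
        (Φ.ratio ^ y.1 • Metric.ball c r) → y.2 = 0 := by
    rintro ⟨s, -⟩
    simp only
    set i := f^[p + s] j
    obtain ⟨a, ha⟩ := hf p i
    rw [hfp s j] at ha
    obtain ⟨b₁, hb₁⟩ := hf (p + s) j
    set b : Space d := Φ.ratio ^ (p + s) • b₀ + b₁
    have hb : b +ᵥ Φ.proto i ∈ Φ.map^[p + s] {b₀ +ᵥ Φ.proto j} := by
      rw [← vadd_set_singleton, iterate_map_vadd, add_vadd]
      exact vadd_mem_vadd_set hb₁
    have hbB : b +ᵥ Φ.proto i ∈ Φ.map^[L + p + s] B := by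
      rw [add_assoc, add_comm L, Function.iterate_add_apply]
      exact iterate_map_mono _ (singleton_subset_iff.2 hτ₀) hb
    obtain ⟨ε, hε, k, hk⟩ := exists_repulsion_of_recurrent hFLC hNP hp ha
      (iterate_map_mem_tilingSpace hB (L + p + s)) hbB
    -- The period is `λ^n δ` while repulsion is measured against `λ^(p q)`; the quotient of the
    -- scales is `λ^(L + p + s)`.
    have hε' : 0 < ε / Φ.ratio ^ (L + p + s) := div_pos hε (pow_pos Φ.ratio_pos _)
    filter_upwards [prod_mem_prod (Ici_mem_atTop (L + p + s + p * k))
      (Metric.ball_mem_nhds (0 : Space d) hε')]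
    rintro ⟨n, δ⟩ ⟨hn, hδ⟩ q hq hagree
    simp only at hn hδ hq hagree ⊢
    subst hq
    rw [mem_ball_zero_iff, lt_div_iff₀ (pow_pos Φ.ratio_pos _)] at hδ
    have hkq : k ≤ q := by
      have h1 : p * k ≤ p * q := by
        have := mem_Ici.1 hn
        omega
      exact Nat.le_of_mul_le_mul_left h1 hp
    have heq : (Φ.ratio ^ (p * q) • b) +ᵥ Φ.map^[p * q] {Φ.proto i} =
        Φ.map^[p * q] {b +ᵥ Φ.proto i} := by
      rw [← iterate_map_vadd, vadd_set_singleton]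
    have hsub : Φ.map^[p * q] {b +ᵥ Φ.proto i} ⊆ Φ.map^[L + p + s + p * q] B := by
      rw [add_comm, Function.iterate_add_apply]
      exact iterate_map_mono _ (singleton_subset_iff.2 hbB)
    have h0 := hk q hkq _ (iterate_map_mem_tilingSpace hB (L + p + s + p * q)).1.1
      (Φ.ratio ^ (p * q) • b) (Φ.ratio ^ (L + p + s + p * q) • δ) (heq ▸ hsub) ?_ ?_
    · exact (smul_eq_zero_iff_right (pow_pos Φ.ratio_pos _).ne').1 h0
    · rw [norm_smul, Real.norm_of_nonneg (pow_pos Φ.ratio_pos _).le, pow_add]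
      have h2 := mul_lt_mul_of_pos_right hδ (pow_pos Φ.ratio_pos (p * q))
      linarith
    · rw [heq]
      intro σ hσ
      obtain ⟨x, hx⟩ := σ.nonempty
      have hx1 : x ∈ Φ.ratio ^ (L + p + s + p * q) • Metric.ball c r := by
        have h3 := supp_subset_of_mem_iterate_map_singleton hσ hx
        have h4 : (b +ᵥ Φ.proto i).supp ⊆ Φ.ratio ^ (p + s) • Φ.ratio ^ L • Metric.ball c r :=
          (supp_subset_of_mem_iterate_map_singleton hb).trans (smul_set_mono hsupp)
        have h5 := smul_set_mono (a := Φ.ratio ^ (p * q)) h4 h3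
        rw [smul_smul, smul_smul, ← pow_add, ← pow_add] at h5
        convert h5 using 2
        congr 1
        ring
      exact mem_vadd_iff.1 ((hagree.mem_iff hx1 hx).1 (hsub hσ))
  have hlarge : ∀ᶠ y : ℕ × Space d in atTop ×ˢ 𝓝 0, L + p ≤ y.1 :=
    (eventually_ge_atTop (L + p)).prod_inl _
  filter_upwards [eventually_all.2 hs, hlarge] with y hy hy1
  refine hy ⟨(y.1 - (L + p)) % p, Nat.mod_lt _ hp⟩ ((y.1 - (L + p)) / p) ?_
  simp only
  have := Nat.mod_add_div (y.1 - (L + p)) p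
  omega

end SelfSimilarSubstitution

namespace SelfSimilarSubstitution

variable {Φ : SelfSimilarSubstitution d M}

theorem agreeOn_iterate_of_le {P Q : Set (Tile d M)} {Y : Set (Space d)} {m n : ℕ} (hmn : m ≤ n)
    (h : AgreeOn (Φ.map^[m] P) (Φ.map^[m] Q) (Φ.ratio ^ m • Y)) :
    AgreeOn (Φ.map^[n] P) (Φ.map^[n] Q) (Φ.ratio ^ n • Y) := by
  obtain ⟨k, rfl⟩ := Nat.exists_eq_add_of_le' hmn
  rw [Function.iterate_add_apply, Function.iterate_add_apply, pow_add, mul_smul]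
  exact h.iterate_map k

theorem agreeOn_iterate_vadd {P Q : Set (Tile d M)} {Y Y' : Set (Space d)} {n : ℕ}
    (h : AgreeOn (Φ.map^[n] P) (Φ.map^[n] Q) (Φ.ratio ^ n • Y)) {w : Space d}
    (hY : ∀ y ∈ Y', y - w ∈ Y) :
    AgreeOn (Φ.map^[n] (w +ᵥ P)) (Φ.map^[n] (w +ᵥ Q)) (Φ.ratio ^ n • Y') := by
  rw [iterate_map_vadd, iterate_map_vadd]
  refine (h.vadd _).mono ?_
  rintro _ ⟨y, hy, rfl⟩
  refine ⟨Φ.ratio ^ n • (y - w), smul_mem_smul_set (hY y hy), ?_⟩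
  simp only [vadd_eq_add, smul_sub]
  abel

/-! ### The points at which two tilings eventually coincide -/

variable (Φ) in
/-- The points `x` such that, for some `n`, `Φ^n(T)` and `Φ^n(T')` agree at `λ^n x`. -/
def coincidenceSet (T T' : Set (Tile d M)) : Set (Space d) :=
  {x | ∃ n : ℕ, AgreeOn (Φ.map^[n] T) (Φ.map^[n] T') (Φ.ratio ^ n • {x})}

theorem mem_coincidenceSet_vadd {T T' : Set (Tile d M)} {v x : Space d} :
    x ∈ Φ.coincidenceSet (v +ᵥ T) (v +ᵥ T') ↔ x - v ∈ Φ.coincidenceSet T T' := by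
  have key : ∀ {T T' : Set (Tile d M)} {v x : Space d}, x - v ∈ Φ.coincidenceSet T T' →
      x ∈ Φ.coincidenceSet (v +ᵥ T) (v +ᵥ T') := by
    rintro T T' v x ⟨n, hn⟩
    exact ⟨n, agreeOn_iterate_vadd hn (by simp)⟩
  refine ⟨fun h => ?_, key⟩
  have h1 := key (T := v +ᵥ T) (T' := v +ᵥ T') (v := -v) (x := x - v) (by simpa using h)
  rwa [neg_vadd_vadd, neg_vadd_vadd] at h1

theorem mem_coincidenceSet_iterate {T T' : Set (Tile d M)} {x : Space d} (n : ℕ) :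
    Φ.ratio ^ n • x ∈ Φ.coincidenceSet (Φ.map^[n] T) (Φ.map^[n] T') ↔
      x ∈ Φ.coincidenceSet T T' := by
  have key : ∀ k : ℕ, AgreeOn (Φ.map^[k] (Φ.map^[n] T)) (Φ.map^[k] (Φ.map^[n] T'))
      (Φ.ratio ^ k • {Φ.ratio ^ n • x}) ↔
      AgreeOn (Φ.map^[k + n] T) (Φ.map^[k + n] T') (Φ.ratio ^ (k + n) • {x}) := by
    intro k
    rw [Function.iterate_add_apply, Function.iterate_add_apply, pow_add, mul_smul, smul_set_singleton,
      smul_set_singleton, smul_set_singleton]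
  constructor
  · rintro ⟨k, hk⟩
    exact ⟨k + n, (key k).1 hk⟩
  · rintro ⟨k, hk⟩
    exact ⟨k, (key k).2 (agreeOn_iterate_of_le (Nat.le_add_right _ _) hk)⟩

theorem isOpen_coincidenceSet {T T' : Set (Tile d M)} (hT : T ∈ Φ.tilingSpace)
    (hT' : T' ∈ Φ.tilingSpace) : IsOpen (Φ.coincidenceSet T T') := by
  rw [isOpen_iff_mem_nhds]
  rintro x ⟨n, hn⟩
  rw [smul_set_singleton] at hn
  obtain ⟨r, hr, h⟩ := exists_ball_agreeOn (iterate_map_mem_tilingSpace hT n)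
    (iterate_map_mem_tilingSpace hT' n) hn
  have h1 : ∀ᶠ y in 𝓝 x, Φ.ratio ^ n • y ∈ Metric.ball (Φ.ratio ^ n • x) r :=
    (continuous_const_smul (Φ.ratio ^ n)).continuousAt.eventually (Metric.ball_mem_nhds _ hr)
  filter_upwards [h1] with y hy
  refine ⟨n, ?_⟩
  rw [smul_set_singleton]
  exact h.mono (singleton_subset_iff.2 hy)

theorem mem_coincidenceSet_of_agreeOn {S S' B B' : Set (Tile d M)} {Y : Set (Space d)}
    (h : AgreeOn S B Y) (h' : AgreeOn S' B' Y) {x : Space d} (hx : x ∈ Y)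
    (hxU : x ∈ Φ.coincidenceSet S S') : x ∈ Φ.coincidenceSet B B' := by
  obtain ⟨n, hn⟩ := hxU
  have hxY : ({x} : Set (Space d)) ⊆ Y := singleton_subset_iff.2 hx
  exact ⟨n, (((h.mono hxY).iterate_map n).symm.trans hn).trans ((h'.mono hxY).iterate_map n)⟩

theorem subset_coincidenceSet {T T' : Set (Tile d M)} {X : Set (Space d)}
    (h : AgreeOn T T' X) : X ⊆ Φ.coincidenceSet T T' :=
  fun x hx => ⟨0, by simpa using h.mono (singleton_subset_iff.2 hx)⟩

/-- If the origin is a point of coincidence, iterates of `T` and `T'` agree on larger and larger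
balls. -/
theorem exists_agreeOn_ball_of_zero_mem {T T' : Set (Tile d M)} (hT : T ∈ Φ.tilingSpace)
    (hT' : T' ∈ Φ.tilingSpace) (h : 0 ∈ Φ.coincidenceSet T T') :
    ∃ (N : ℕ) (r : ℝ), 0 < r ∧ ∀ n, N ≤ n →
      AgreeOn (Φ.map^[n] T) (Φ.map^[n] T') (Metric.ball 0 (Φ.ratio ^ n * r)) := by
  obtain ⟨N, hN⟩ := h
  rw [smul_set_singleton] at hN
  obtain ⟨r, hr, h⟩ := exists_ball_agreeOn (iterate_map_mem_tilingSpace hT N)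
    (iterate_map_mem_tilingSpace hT' N) hN
  have hpos : ∀ n : ℕ, 0 < Φ.ratio ^ n := fun n => pow_pos Φ.ratio_pos n
  have hball : ∀ n : ℕ, Φ.ratio ^ n • Metric.ball (0 : Space d) (r / Φ.ratio ^ N) =
      Metric.ball 0 (Φ.ratio ^ n * (r / Φ.ratio ^ N)) := by
    intro n
    rw [smul_ball (hpos n).ne', smul_zero, Real.norm_of_nonneg (hpos n).le]
  refine ⟨N, r / Φ.ratio ^ N, div_pos hr (hpos N), fun n hn => ?_⟩
  rw [← hball]
  refine agreeOn_iterate_of_le hn ?_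
  rw [hball, mul_div_cancel₀ _ (hpos N).ne']
  simpa using h

/-! ### The tiling metric and stable equivalence. -/

theorem tilingDist_nonneg (T T' : Set (Tile d M)) : 0 ≤ tilingDist T T' := by
  refine Real.sInf_nonneg ?_
  rintro x (rfl | ⟨hx, -⟩)
  · exact zero_le_one
  · exact hx.le

theorem tilingDist_le_of_agreeOn {T T' : Set (Tile d M)} {ε : ℝ} (hε : 0 < ε)
    (h : AgreeOn T T' (Metric.ball 0 (1 / ε))) : tilingDist T T' ≤ ε := by
  refine csInf_le ⟨0, ?_⟩ (Or.inr ⟨hε, 0, 0, by simpa, by simpa, ?_⟩)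
  · rintro x (rfl | ⟨hx, -⟩)
    · exact zero_le_one
    · exact hx.le
  · rw [neg_zero, zero_vadd, zero_vadd]
    exact agreeOn_ball_zero_iff.1 h.symm

theorem exists_agreeOn_of_tilingDist_lt {T T' : Set (Tile d M)} {η : ℝ} (hη : η ≤ 1)
    (h : tilingDist T T' < η) :
    ∃ w : Space d, ‖w‖ < η ∧ AgreeOn T' (w +ᵥ T) (Metric.ball 0 (1 / 2)) := by
  unfold tilingDist at h
  obtain ⟨ε, hmem, hε⟩ := exists_lt_of_csInf_lt ⟨1, mem_union_left _ (mem_singleton _)⟩ h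
  rcases hmem with rfl | ⟨hε0, v, v', hv, hv', heq⟩
  · exact absurd hε (not_lt.2 hη)
  have h1 := (agreeOn_ball_zero_iff.2 heq).vadd v'
  rw [vadd_neg_vadd, vadd_vadd] at h1
  -- Since `ε < 1`, the radius `1 / ε` exceeds `1`, and a shift shorter than `1 / 2` leaves radius
  -- `1 / 2`.
  refine ⟨v' + -v, ?_, h1.mono fun x hx => ?_⟩
  · linarith [norm_add_le v' (-v), norm_neg v]
  · rw [mem_vadd_set_iff_neg_vadd_mem, vadd_eq_add, mem_ball_zero_iff]
    rw [mem_ball_zero_iff] at hx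
    have h2 : 1 < 1 / ε := by
      rw [lt_div_iff₀ hε0]
      linarith
    linarith [norm_add_le (-v') x, norm_neg v']

/-- Stable equivalence means that some iterates agree at the origin. -/
theorem stablyEquiv_iff {T T' : Set (Tile d M)} (hT : T ∈ Φ.tilingSpace)
    (hT' : T' ∈ Φ.tilingSpace) : Φ.StablyEquiv T T' ↔ 0 ∈ Φ.coincidenceSet T T' := by
  constructor
  · rintro ⟨-, hlim⟩
    obtain ⟨r, hr, hsep⟩ := Φ.exists_separation
    have hden : 0 < Φ.ratio + 1 := by linarith [Φ.ratio_pos]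
    -- Chosen so that `ratio • w k` and `w (k + 1)` differ by less than `r`.
    set η : ℝ := min 1 (r / (Φ.ratio + 1))
    have hη : 0 < η := lt_min one_pos (div_pos hr hden)
    obtain ⟨N, hN⟩ := eventually_atTop.1 (hlim.eventually_lt_const hη)
    have h1 : ∀ k : ℕ, ∃ w : Space d, ‖w‖ < η ∧
        AgreeOn (Φ.map^[N + k] T') (w +ᵥ Φ.map^[N + k] T) (Metric.ball 0 (1 / 2)) := fun k =>
      exists_agreeOn_of_tilingDist_lt (min_le_left _ _) (hN (N + k) (Nat.le_add_right _ _))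
    choose w hw hagree using h1
    -- Both vectors match the next iterates near the origin, so separation identifies them. The
    -- bounded sequence `w` thus grows geometrically, which forces `w 0 = 0`.
    have hstep : ∀ k, w (k + 1) = Φ.ratio • w k := by
      intro k
      obtain ⟨τ, hτ, h0⟩ := (iterate_map_mem_tilingSpace hT' (N + (k + 1))).1.exists_mem 0
      have h2 := (hagree k).map (Φ := Φ)
      rw [map_vadd, ← Function.iterate_succ_apply' Φ.map, ← Function.iterate_succ_apply' Φ.map,
        Nat.succ_eq_add_one, add_assoc] at h2
      have h3 : (0 : Space d) ∈ Φ.ratio • Metric.ball (0 : Space d) (1 / 2) :=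
        ⟨0, by simp, by simp⟩
      have h4 := mem_vadd_iff.1 ((h2.mem_iff h3 h0).1 hτ)
      have h5 := mem_vadd_iff.1 (((hagree (k + 1)).mem_iff (by simp) h0).1 hτ)
      refine neg_injective (hsep _ (iterate_map_mem_tilingSpace hT (N + (k + 1))).1.1 τ
        (isProtoTile_of_mem (iterate_map_mem_tilingSpace hT' _) hτ) _ _ h5 h4 ?_)
      have h6 : η * (Φ.ratio + 1) ≤ r := (le_div_iff₀ hden).1 (min_le_right _ _)
      have h7 : ‖Φ.ratio • w k‖ ≤ Φ.ratio * η := by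
        rw [norm_smul, Real.norm_of_nonneg Φ.ratio_pos.le]
        exact mul_le_mul_of_nonneg_left (hw k).le Φ.ratio_pos.le
      rw [neg_sub_neg]
      linarith [norm_sub_le (Φ.ratio • w k) (w (k + 1)), hw (k + 1)]
    have hpow : ∀ k, w k = Φ.ratio ^ k • w 0 := by
      intro k
      induction k with
      | zero => simp
      | succ k ih => rw [hstep, ih, smul_smul, pow_succ']
    have hw0 : w 0 = 0 := by
      by_contra hne
      obtain ⟨k, hk⟩ := ((Φ.tendsto_ratio_pow.atTop_mul_const
        (norm_pos_iff.2 hne)).eventually_gt_atTop η).exists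
      have h2 := hw k
      rw [hpow, norm_smul, Real.norm_of_nonneg (pow_pos Φ.ratio_pos k).le] at h2
      linarith
    refine ⟨N, ?_⟩
    have h2 := (hagree 0).symm
    rw [hw0, zero_vadd] at h2
    exact h2.mono (by simp [smul_set_singleton])
  · intro h
    obtain ⟨N, r, hr, hN⟩ := exists_agreeOn_ball_of_zero_mem hT hT' h
    refine ⟨hT, Metric.tendsto_nhds.2 fun ε hε => ?_⟩
    filter_upwards [eventually_ge_atTop N,
      (Φ.tendsto_ratio_pow.atTop_mul_const hr).eventually_ge_atTop (1 / (ε / 2))] with n hn hn'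
    have h1 := tilingDist_le_of_agreeOn (half_pos hε)
      ((hN n hn).mono (Metric.ball_subset_ball hn'))
    rw [Real.dist_0_eq_abs, abs_of_nonneg (tilingDist_nonneg _ _)]
    linarith

theorem stablyEquiv_neg_vadd_iff {T T' : Set (Tile d M)} (hT : T ∈ Φ.tilingSpace)
    (hT' : T' ∈ Φ.tilingSpace) (x : Space d) :
    Φ.StablyEquiv (-x +ᵥ T) (-x +ᵥ T') ↔ x ∈ Φ.coincidenceSet T T' := by
  rw [stablyEquiv_iff (vadd_mem_tilingSpace hT _) (vadd_mem_tilingSpace hT' _),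
    mem_coincidenceSet_vadd, zero_sub, neg_neg]

end SelfSimilarSubstitution

/-! ### Caps and cones -/

theorem mem_directionCone_iff {u x : Space d} {α : ℝ} :
    x ∈ directionCone u α ↔ α * ‖x‖ < inner ℝ x u := by
  constructor
  · rintro ⟨t, ht, v, ⟨hv, hvα⟩, rfl⟩
    rw [norm_smul, hv, mul_one, Real.norm_of_nonneg ht.le, real_inner_smul_left, mul_comm]
    exact mul_lt_mul_of_pos_left hvα ht
  · intro h
    have hx : x ≠ 0 := by
      rintro rfl
      simp at h
    have hn : 0 < ‖x‖ := norm_pos_iff.2 hx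
    refine ⟨‖x‖, hn, ‖x‖⁻¹ • x, ⟨?_, ?_⟩, (smul_inv_smul₀ hn.ne' x).symm⟩
    · rw [norm_smul, norm_inv, norm_norm, inv_mul_cancel₀ hn.ne']
    · rwa [real_inner_smul_left, inv_mul_eq_div, lt_div_iff₀ hn]

theorem smul_mem_directionCone_iff {u x : Space d} {α s : ℝ} (hs : 0 < s) :
    s • x ∈ directionCone u α ↔ x ∈ directionCone u α := by
  rw [mem_directionCone_iff, mem_directionCone_iff, norm_smul, real_inner_smul_left,
    Real.norm_of_nonneg hs.le, mul_left_comm, mul_lt_mul_iff_right₀ hs]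

theorem isOpen_directionCone (u : Space d) (α : ℝ) : IsOpen (directionCone u α) := by
  have h : directionCone u α = {x | α * ‖x‖ < inner ℝ x u} := by
    ext x
    exact mem_directionCone_iff
  rw [h]
  exact isOpen_lt (by fun_prop) (by fun_prop)

theorem mem_directionCone_of_inner_pos {u x : Space d} {α : ℝ} (hα : α ≤ 0)
    (hx : 0 < inner ℝ x u) : x ∈ directionCone u α :=
  mem_directionCone_iff.2 ((mul_nonpos_of_nonpos_of_nonneg hα (norm_nonneg x)).trans_lt hx)

theorem mem_directionCap_self {u : Space d} (hu : ‖u‖ = 1) {α : ℝ} (hα : α ≤ 0) :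
    u ∈ directionCap u α :=
  ⟨hu, by rw [real_inner_self_eq_norm_sq, hu]; linarith⟩

/-- For `α ≥ -1` the cone is star-shaped about `u`, and radial projection carries it onto the cap.
In dimension one, `α < -1` would give the disconnected cap `{u, -u}`. -/
theorem isPreconnected_directionCap {u : Space d} (hu : ‖u‖ = 1) {α : ℝ} (hα : α ≤ 0)
    (hα' : -1 ≤ α) : IsPreconnected (directionCap u α) := by
  have hmem : ∀ {x : Space d}, x ∈ directionCap u α → x ∈ directionCone u α := fun {x} hx =>
    ⟨1, one_pos, x, hx, (one_smul ℝ x).symm⟩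
  have hstar : StarConvex ℝ u (directionCone u α) := by
    intro x hx a b ha hb hab
    rw [mem_directionCone_iff] at hx ⊢
    rcases hb.eq_or_lt with rfl | hb
    · obtain rfl : a = 1 := by linarith
      rw [one_smul, zero_smul, add_zero, real_inner_self_eq_norm_sq, hu]
      linarith
    · rw [inner_add_left, real_inner_smul_left, real_inner_smul_left, real_inner_self_eq_norm_sq,
        hu]
      have h1 : b * ‖x‖ - a ≤ ‖a • u + b • x‖ := by
        have h2 := norm_sub_norm_le (b • x) (-(a • u))
        rw [sub_neg_eq_add, norm_neg, norm_smul, norm_smul, hu, Real.norm_of_nonneg ha,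
          Real.norm_of_nonneg hb.le, add_comm (b • x)] at h2
        linarith
      have h3 := mul_le_mul_of_nonpos_left h1 hα
      have h4 := mul_lt_mul_of_pos_left hx hb
      have h5 : 0 ≤ a * (1 + α) := mul_nonneg ha (by linarith)
      linarith
  have himage : directionCap u α = (fun x : Space d => ‖x‖⁻¹ • x) '' directionCone u α := by
    ext v
    constructor
    · intro hv
      exact ⟨v, hmem hv, by simp [hv.1]⟩
    · rintro ⟨_, ⟨t, ht, v, hv, rfl⟩, rfl⟩
      simpa [norm_smul, hv.1, abs_of_pos ht, smul_smul, ht.ne'] using hv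
  rw [himage]
  refine IsPreconnected.image ?_ _ ?_
  · exact (StarConvex.isPathConnected hstar
      (hmem (mem_directionCap_self hu hα))).isConnected.isPreconnected
  · intro x hx
    have hx0 : ‖x‖ ≠ 0 := by
      rw [mem_directionCone_iff] at hx
      rintro h0
      rw [norm_eq_zero] at h0
      simp [h0] at hx
    exact ((continuous_norm.continuousAt.inv₀ hx0).smul continuousAt_id).continuousWithinAt

/-- For `α < -1` the cone contains every nonzero vector, a dense set. -/
theorem neg_one_le_of_agreeOn_directionCone [Nontrivial (Space d)] {T T' : Set (Tile d M)}
    (hne : T ≠ T') {u : Space d} (hu : ‖u‖ = 1) {α : ℝ}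
    (h : AgreeOn T T' (directionCone u α)) : -1 ≤ α := by
  by_contra! hα
  refine hne (eq_of_agreeOn_dense (h.mono fun x (hx : x ∈ ({0} : Set (Space d))ᶜ) => ?_)
    (dense_compl_singleton 0))
  rw [mem_directionCone_iff]
  have h1 := (abs_le.1 (abs_real_inner_le_norm x u)).1
  rw [hu, mul_one] at h1
  have h2 : α * ‖x‖ < -1 * ‖x‖ := mul_lt_mul_of_pos_right hα (norm_pos_iff.2 hx)
  linarith

/-! ### Branch pairs from coincidence sets, and limits of preimages. -/

namespace SelfSimilarSubstitution

variable {Φ : SelfSimilarSubstitution d M}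

theorem branchPair_of_directionCone_subset {A A' : Set (Tile d M)} (hA : A ∈ Φ.tilingSpace)
    (hA' : A' ∈ Φ.tilingSpace) {u : Space d} (hu : ‖u‖ = 1) {α : ℝ} (hα : α ≤ 0) (hα' : -1 ≤ α)
    (h0 : 0 ∉ Φ.coincidenceSet A A') (hcone : directionCone u α ⊆ Φ.coincidenceSet A A') :
    (A, A') ∈ Φ.branchPairs ∧ ∃ S : Set (Space d), Φ.IsAsymptoticSector A A' S ∧
      directionCap u α ⊆ S := by
  have hhalf : Φ.StablyEquivOnHalfSpace A A' u := fun x hx =>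
    (stablyEquiv_neg_vadd_iff hA hA' x).2 (hcone (mem_directionCone_of_inner_pos hα hx))
  refine ⟨⟨hA, hA', fun h => h0 ((stablyEquiv_iff hA hA').1 h), u, hu, hhalf⟩, _,
    ⟨u, hu, hhalf, rfl⟩, ?_⟩
  refine (isPreconnected_directionCap hu hα hα').subset_connectedComponentIn
    (mem_directionCap_self hu hα) fun v hv => ⟨hv.1, fun t ht => ?_⟩
  exact (stablyEquiv_neg_vadd_iff hA hA' _).2 (hcone ⟨t, ht, v, hv, rfl⟩)

/-- If `T ≠ T'` agree on all inflations of a ball, then the preimages of `(T, T')` under `Φ^n`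
accumulate at a pair `(A, A')` that does not coincide at the origin, and in each ball, up to a
small translation, the coincidence set of `(A, A')` is that of `(T, T')` scaled by `λ^(-n)`. -/
theorem exists_limit_pair [Nontrivial (Space d)] (hFLC : HasFLC Φ.tilingSpace)
    (hNP : NonPeriodic Φ.tilingSpace) (𝒰 : Ultrafilter ℕ) (h𝒰 : (𝒰 : Filter ℕ) ≤ atTop)
    {T T' : Set (Tile d M)} (hT : T ∈ Φ.tilingSpace)
    (hT' : T' ∈ Φ.tilingSpace) (hne : T ≠ T') {u : Space d}
    (hagree : ∀ s : ℝ, 0 < s → AgreeOn T T' (s • Metric.ball u 1)) :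
    ∃ A ∈ Φ.tilingSpace, ∃ A' ∈ Φ.tilingSpace, ∃ v : ℕ → Space d, Tendsto v 𝒰 (𝓝 0) ∧
      0 ∉ Φ.coincidenceSet A A' ∧ ∀ R : ℝ, ∀ᶠ n in (𝒰 : Filter ℕ), ∀ y : Space d, ‖y‖ < R →
        (Φ.ratio ^ n • (v n + y) ∈ Φ.coincidenceSet T T' ↔ y ∈ Φ.coincidenceSet A A') := by
  choose S hS hST using fun n => exists_iterate_map_eq hT n
  choose S' hS' hST' using fun n => exists_iterate_map_eq hT' n
  obtain ⟨A, hA, v, hv, hlim⟩ := exists_limit hFLC 𝒰 hS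
  obtain ⟨A', hA', v', hv', hlim'⟩ := exists_limit hFLC 𝒰 hS'
  have hnorm : ∀ {w : ℕ → Space d}, Tendsto w 𝒰 (𝓝 0) → ∀ ε : ℝ, 0 < ε →
      ∀ᶠ n in (𝒰 : Filter ℕ), ‖w n‖ < ε := fun hw ε hε => by
    simpa using hw.eventually (Metric.ball_mem_nhds 0 hε)
  set w : ℕ → Space d := fun n => v' n - v n
  have hw : Tendsto w 𝒰 (𝓝 0) := by simpa using hv'.sub hv
  have hnear : ∀ R : ℝ, ∀ᶠ n in (𝒰 : Filter ℕ),
      AgreeOn (-v n +ᵥ S n) A (Metric.ball 0 R) ∧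
      AgreeOn (-v n +ᵥ S' n) (w n +ᵥ A') (Metric.ball 0 R) := by
    intro R
    filter_upwards [hlim (R + 1), hlim' (R + 1), hnorm hv 1 one_pos] with n h1 h2 h3
    have hsub : Metric.ball 0 R ⊆ -v n +ᵥ Metric.ball (0 : Space d) (R + 1) := by
      intro x hx
      rw [mem_vadd_set_iff_neg_vadd_mem, neg_neg, vadd_eq_add, mem_ball_zero_iff]
      rw [mem_ball_zero_iff] at hx
      linarith [norm_add_le (v n) x]
    have h4 := (h1.vadd (-v n)).mono hsub
    have h5 := (h2.vadd (-v n)).mono hsub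
    rw [neg_vadd_vadd] at h4
    rw [vadd_vadd, neg_add_eq_sub] at h5
    exact ⟨h4, h5⟩
  have hcoin : ∀ᶠ n in (𝒰 : Filter ℕ), AgreeOn (Φ.map^[n] A) (Φ.map^[n] (w n +ᵥ A'))
      (Φ.ratio ^ n • Metric.ball u (1 / 2)) := by
    filter_upwards [hnear (‖u‖ + 1), hnorm hv (1 / 2) (by norm_num)] with n hn hvn
    have hsub : Metric.ball u (1 / 2) ⊆ Metric.ball (0 : Space d) (‖u‖ + 1) := by
      intro x hx
      rw [mem_ball_iff_norm] at hx
      rw [mem_ball_zero_iff]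
      linarith [norm_sub_norm_le x u]
    have h1 : AgreeOn (Φ.map^[n] (S n)) (Φ.map^[n] (S' n)) (Φ.ratio ^ n • Metric.ball u 1) := by
      rw [hST, hST']
      exact hagree _ (pow_pos Φ.ratio_pos n)
    have h2 := agreeOn_iterate_vadd (Y' := Metric.ball u (1 / 2)) h1 (w := -v n) (by
      intro y hy
      rw [mem_ball_iff_norm] at hy ⊢
      rw [show y - -v n - u = (y - u) + v n by abel]
      linarith [norm_add_le (y - u) (v n)])
    exact (((hn.1.mono hsub).iterate_map n).symm.trans h2).trans ((hn.2.mono hsub).iterate_map n)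
  -- For `m ≤ n`, `Φ^n(w m +ᵥ A')` and `Φ^n(w n +ᵥ A')` both agree with `Φ^n(A)` on an inflated
  -- ball. Repulsion for `A'` gives `w n = w m`, so `w` is eventually constant, and its limit is
  -- `0`.
  have hw0 : ∀ᶠ n in (𝒰 : Filter ℕ), w n = 0 := by
    obtain ⟨t, ht, t', ht', hrep⟩ := mem_prod_iff.1
      (eventually_repulsion hFLC hNP hA' u (r := 1 / 4) (by norm_num))
    obtain ⟨ε, hε, hεt⟩ := Metric.mem_nhds_iff.1 ht'
    filter_upwards [hcoin, hnorm hw (ε / 2) (half_pos hε), hnorm hw (1 / 4) (by norm_num)]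
      with m hm1 hm2 hm3
    have hconst : ∀ᶠ n in (𝒰 : Filter ℕ), w n = w m := by
      filter_upwards [hcoin, hnorm hw (ε / 2) (half_pos hε), h𝒰 ht,
        h𝒰 (eventually_ge_atTop m)] with n hn1 hn2 hn3 hn4
      have h1 := (agreeOn_iterate_of_le hn4 hm1).symm.trans hn1
      have h2 := agreeOn_iterate_vadd (Y' := Metric.ball u (1 / 4)) h1 (w := -w m) (by
        intro y hy
        rw [mem_ball_iff_norm] at hy ⊢
        rw [show y - -w m - u = (y - u) + w m by abel]
        linarith [norm_add_le (y - u) (w m)])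
      rw [neg_vadd_vadd, vadd_vadd, neg_add_eq_sub, iterate_map_vadd n (w n - w m)] at h2
      have h3 : w n - w m ∈ t' := hεt (by
        rw [mem_ball_zero_iff]
        linarith [norm_sub_le (w n) (w m)])
      exact sub_eq_zero.1 (hrep (mk_mem_prod hn3 h3) h2)
    exact tendsto_nhds_unique (tendsto_const_nhds.congr'
      (hconst.mono fun n hn => hn.symm)) hw
  have hnear' : ∀ R : ℝ, ∀ᶠ n in (𝒰 : Filter ℕ),
      AgreeOn (-v n +ᵥ S n) A (Metric.ball 0 R) ∧
      AgreeOn (-v n +ᵥ S' n) A' (Metric.ball 0 R) := by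
    intro R
    filter_upwards [hnear R, hw0] with n hn h0
    rwa [h0, zero_vadd] at hn
  refine ⟨A, hA, A', hA', v, hv, fun h0 => hne ?_, fun R => ?_⟩
  -- Coincidence at the origin would spread to balls of radius `λ^n r` and, through the
  -- approximation, make `T` and `T'` agree everywhere.
  · obtain ⟨N, r, hr, hN⟩ := exists_agreeOn_ball_of_zero_mem hA hA' h0
    have hr' : 0 < Φ.ratio ^ N * r := mul_pos (pow_pos Φ.ratio_pos N) hr
    refine eq_of_agreeOn_dense (X := univ) (agreeOn_iff.2 fun x _ => ?_) dense_univ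
    obtain ⟨n, ⟨⟨hn1, hn2⟩, hn3⟩, hn4⟩ := (((hnear' r).and (hnorm hv (r / 2)
      (half_pos hr))).and (h𝒰 ((eventually_ge_atTop N).and
      ((Φ.tendsto_ratio_pow.atTop_mul_const (half_pos hr)).eventually_gt_atTop ‖x‖)))).exists
    have hpos : 0 < Φ.ratio ^ n := pow_pos Φ.ratio_pos n
    have h1 : AgreeOn (Φ.map^[n] A) (Φ.map^[n] A') (Φ.ratio ^ n • Metric.ball 0 r) := by
      rw [smul_ball hpos.ne', smul_zero, Real.norm_of_nonneg hpos.le]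
      exact hN n hn4.1
    have h2 := ((hn1.iterate_map n).trans h1).trans (hn2.iterate_map n).symm
    have h3 := agreeOn_iterate_vadd (Y' := Metric.ball 0 (r / 2)) h2 (w := v n) (by
      intro y hy
      rw [mem_ball_zero_iff] at hy ⊢
      linarith [norm_sub_le y (v n)])
    rw [vadd_neg_vadd, vadd_neg_vadd, hST, hST'] at h3
    refine fun τ hτ => h3.mem_iff ?_ hτ
    rw [smul_ball hpos.ne', smul_zero, Real.norm_of_nonneg hpos.le, mem_ball_zero_iff]
    exact hn4.2
  · filter_upwards [hnear' R] with n hn y hy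
    have hy' : y ∈ Metric.ball (0 : Space d) R := by simpa using hy
    rw [← hST n, ← hST' n, mem_coincidenceSet_iterate]
    have h1 : v n + y ∈ Φ.coincidenceSet (S n) (S' n) ↔
        y ∈ Φ.coincidenceSet (-v n +ᵥ S n) (-v n +ᵥ S' n) := by
      rw [mem_coincidenceSet_vadd, sub_neg_eq_add, add_comm]
    rw [h1]
    exact ⟨mem_coincidenceSet_of_agreeOn hn.1 hn.2 hy',
      mem_coincidenceSet_of_agreeOn hn.1.symm hn.2.symm hy'⟩

end SelfSimilarSubstitution

end SubstTiling

/-! ### Proof of the proposition. -/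

open SubstTiling SelfSimilarSubstitution in
theorem mainTheorem9 {d : ℕ} {M : Type*} (Φ : SubstTiling.SelfSimilarSubstitution d M)
    (hFLC : SubstTiling.HasFLC Φ.tilingSpace) (hNP : SubstTiling.NonPeriodic Φ.tilingSpace)
    (T T' : Set (SubstTiling.Tile d M)) (hT : T ∈ Φ.tilingSpace) (hT' : T' ∈ Φ.tilingSpace)
    (hne : T ≠ T') (u : SubstTiling.Space d) (hu : ‖u‖ = 1) (α : ℝ) (hα : α ≤ 0)
    (hagree : SubstTiling.AgreeOn T T' (SubstTiling.directionCone u α)) :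
    (∃ p ∈ Φ.branchPairs, ∃ S : Set (SubstTiling.Space d),
      Φ.IsAsymptoticSector p.1 p.2 S ∧ SubstTiling.directionCap u α ⊆ S) ∧
    (α < 0 → ∃ z : SubstTiling.Space d, (-z +ᵥ T, -z +ᵥ T') ∈ Φ.branchPairs ∧
      ∃ S : Set (SubstTiling.Space d),
        Φ.IsAsymptoticSector (-z +ᵥ T) (-z +ᵥ T') S ∧ SubstTiling.directionCap u α ⊆ S) := by
  have hnt : Nontrivial (Space d) := nontrivial_of_ne u 0 fun h => by simp [h] at hu
  have hα' := neg_one_le_of_agreeOn_directionCone hne hu hagree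
  set X := directionCone u α with hX
  set 𝒰 : Ultrafilter ℕ := hyperfilter ℕ
  have h𝒰 : (𝒰 : Filter ℕ) ≤ atTop := Nat.hyperfilter_le_atTop
  have hpos : ∀ n : ℕ, 0 < Φ.ratio ^ n := fun n => pow_pos Φ.ratio_pos n
  have hball : ∀ s : ℝ, 0 < s → s • Metric.ball u 1 ⊆ X := by
    rintro s hs _ ⟨x, hx, rfl⟩
    refine (smul_mem_directionCone_iff hs).2 (mem_directionCone_of_inner_pos hα ?_)
    rw [mem_ball_iff_norm] at hx
    have h1 := (abs_le.1 (abs_real_inner_le_norm (x - u) u)).1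
    rw [inner_sub_left, real_inner_self_eq_norm_sq, hu] at h1
    linarith
  obtain ⟨A, hA, A', hA', v, hv, h0, hscale⟩ := exists_limit_pair hFLC hNP 𝒰 h𝒰 hT hT' hne
    (u := u) fun s hs => hagree.mono (hball s hs)
  -- Openness of `X` absorbs the shift `v n`, and invariance under scaling absorbs `λ^n`.
  have hXA : X ⊆ Φ.coincidenceSet A A' := by
    intro y hy
    have h1 : Tendsto (fun n => v n + y) 𝒰 (𝓝 y) := by simpa using hv.add_const y
    obtain ⟨n, hn1, hn2⟩ := ((hscale (‖y‖ + 1)).and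
      (h1.eventually ((isOpen_directionCone u α).mem_nhds hy))).exists
    exact (hn1 y (lt_add_one _)).1
      (subset_coincidenceSet hagree ((smul_mem_directionCone_iff (hpos n)).2 hn2))
  refine ⟨⟨(A, A'), branchPair_of_directionCone_subset hA hA' hu hα hα' h0 hXA⟩, fun hneg => ?_⟩
  have hmem : ∀ᶠ n in (𝒰 : Filter ℕ), Φ.ratio ^ n • v n ∉ Φ.coincidenceSet T T' := by
    filter_upwards [hscale 1] with n hn h
    exact h0 ((hn 0 (by simp)).1 (by simpa using h))
  -- Otherwise `λ^(-n) c - v n` would lie in `X`, hence in `U(A, A')`, and scaling back would put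
  -- `c` into `U(T, T')`.
  have hapex : ∀ c, c ∉ Φ.coincidenceSet T T' → ∀ᶠ n in (𝒰 : Filter ℕ),
      c - Φ.ratio ^ n • v n ∉ X := by
    intro c hc
    have h1 : ∀ᶠ n in (𝒰 : Filter ℕ), ‖v n‖ < 1 := hv.norm.eventually_lt_const (by simp)
    filter_upwards [hscale 2, h1, h𝒰 (Φ.tendsto_ratio_pow.eventually_gt_atTop ‖c‖)]
      with n hn1 hn2 hn3 hcX
    have h2 : ‖(Φ.ratio ^ n)⁻¹ • c‖ < 1 := by
      rw [norm_smul, norm_inv, Real.norm_of_nonneg (hpos n).le, inv_mul_lt_iff₀ (hpos n), mul_one]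
      exact hn3
    have h3 := hn1 ((Φ.ratio ^ n)⁻¹ • c - v n)
      (by linarith [norm_sub_le ((Φ.ratio ^ n)⁻¹ • c) (v n)])
    rw [add_sub_cancel, smul_inv_smul₀ (hpos n).ne'] at h3
    refine hc (h3.2 (hXA ?_))
    rwa [hX, ← smul_mem_directionCone_iff (hpos n), smul_sub, smul_inv_smul₀ (hpos n).ne']
  obtain ⟨m, hm⟩ := hmem.exists
  set c := Φ.ratio ^ m • v m
  -- With `c n = λ^n v n`, the conditions `c - c n ∉ X` and `c n ∉ X` give `⟪c, u⟫ ≤ ⟪c n, u⟫ ≤ α ‖c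
  -- n‖`; division by `α < 0` bounds `‖c n‖`.
  have hbdd : ∀ᶠ n in (𝒰 : Filter ℕ),
      Φ.ratio ^ n • v n ∈ Metric.closedBall (0 : Space d) (inner ℝ c u / α) := by
    filter_upwards [hmem, hapex c hm] with n hn1 hn2
    have h1 : Φ.ratio ^ n • v n ∉ X := fun h => hn1 (subset_coincidenceSet hagree h)
    rw [hX, mem_directionCone_iff, not_lt] at h1 hn2
    rw [inner_sub_left] at hn2
    rw [mem_closedBall_zero_iff, le_div_iff_of_neg hneg, mul_comm]
    linarith [mul_nonpos_of_nonpos_of_nonneg hα (norm_nonneg (c - Φ.ratio ^ n • v n))]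
  obtain ⟨z, -, hz⟩ := (isCompact_closedBall (0 : Space d) (inner ℝ c u / α)).ultrafilter_le_nhds
    (𝒰.map fun n => Φ.ratio ^ n • v n) (le_principal_iff.2 hbdd)
  have hz : Tendsto (fun n => Φ.ratio ^ n • v n) 𝒰 (𝓝 z) := hz
  refine ⟨z, branchPair_of_directionCone_subset (vadd_mem_tilingSpace hT _)
    (vadd_mem_tilingSpace hT' _) hu hα hα' ?_ fun x hx => ?_⟩
  · rw [mem_coincidenceSet_vadd, zero_sub, neg_neg]
    exact (isOpen_coincidenceSet hT hT').isClosed_compl.mem_of_tendsto hz hmem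
  · rw [mem_coincidenceSet_vadd, sub_neg_eq_add]
    -- If `x + z` were not in `U(T, T')`, then `x + z - c n` would avoid the open set `X`, and so
    -- would its limit `x`.
    by_contra hc
    have h1 := (isOpen_directionCone u α).isClosed_compl.mem_of_tendsto
      (hz.const_sub (x + z)) (hapex _ hc)
    rw [add_sub_cancel_right] at h1
    exact h1 hx
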